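/- Lemma 2.2 (coercivity of the effective operator). Let $d\ge 2$, and let $\omega\subset\mathbb{R}^d$ be an unbounded Lipschitz domain (open, connected, nonempty) with 1-periodic structure, i.e. its characteristic function is 1-periodic (invariant under translation by $\mathbb{Z}^d$). Let $Y=(-\tfrac12,\tfrac12]^d$ and $\theta=|Y\cap\omega|$. Let $H^1_{\mathrm{per}}(Y\cap\omega)$ be the closure in $H^1(Y\cap\omega)$ of the (restrictions of) smooth 1-periodic functions. Let $\mu_0,\mu_1>0$. Then there exist constants $C_1,C>0$, depending only on $\mu_0,\mu_1,\omega$ and $d$, such that the following holds for every $A\in C^1(\mathbb{R}^d\times\mathbb{R}^d;\mathbb{R}^d)$ such that $A(\cdot,\xi)$ is 1-periodic for every $\xi$ and, for all $y,\xi,\xi'\in\mathbb{R}^d$, $$\langle A(y,\xi)-A(y,\xi'),\xi-\xi'\rangle\ge\mu_0|\xi-\xi'|^2,\qquad |A(y,\xi)-A(y,\xi')|\le\mu_1|\xi-\xi'|,\qquad A(y,0)=0 .$$ For every $\xi\in\mathbb{R}^d$ the cell problem has a weak solution (a corrector) $N(\cdot,\xi)$: a function $N(\cdot,\xi)\in H^1_{\mathrm{per}}(Y\cap\omega)$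 with $\frac{1}{|Y\cap\omega|}\int_{Y\cap\omega}N(\cdot,\xi)=0$ and $$\int_{Y\cap\omega}A(y,\xi+\nabla N(y,\xi))\cdot\nabla v(y)\,dy=0\qquad\text{for all } v\in H^1_{\mathrm{per}}(Y\cap\omega);$$ and for any choice of such correctors, the effective field $$\widehat A(\xi)=\theta^{-1}\int_{Y\cap\omega}A(y,\xi+\nabla N(y,\xi))\,dy$$ satisfies, for all $\xi,\xi'\in\mathbb{R}^d$, $$\langle\widehat A(\xi)-\widehat A(\xi'),\xi-\xi'\rangle\ge C_1|\xi-\xi'|^2,\qquad |\widehat A(\xi)-\widehat A(\xi')|\le C|\xi-\xi'|,\qquad \widehat A(0)=0 .$$ -/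

import Mathlib

open MeasureTheory
open scoped ENNReal

namespace PerforatedHomogenization

/-- `ℝᵈ` with its Euclidean norm and inner product. -/
abbrev E (d : ℕ) : Type := EuclideanSpace ℝ (Fin d)

/-- The vector of `ℝᵈ` with the given integer coordinates. -/
noncomputable def latticeVec {d : ℕ} (k : Fin d → ℤ) : E d :=
  WithLp.toLp 2 fun i => (k i : ℝ)

/-- A function on `ℝᵈ` is 1-periodic if it is invariant under all integer translations. -/
def IsOnePeriodic {d : ℕ} {β : Type*} (f : E d → β) : Prop :=
  ∀ (k : Fin d → ℤ) (y : E d), f (y + latticeVec k) = f y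

/-- The half-open unit cell `Y = (-1/2, 1/2]ᵈ`. -/
def unitCell (d : ℕ) : Set (E d) :=
  {y | ∀ i, y i ∈ Set.Ioc (-(1 / 2) : ℝ) (1 / 2)}

/-- The perforated cell `Y ∩ ω`. -/
def perforatedCell {d : ℕ} (ω : Set (E d)) : Set (E d) :=
  unitCell d ∩ ω

/-- A Lipschitz domain: a nonempty connected open set which, near each of its boundary points,
is the region above the graph of a Lipschitz function. The graph is taken over the hyperplane
orthogonal to a unit vector `ν`: the height of `x` is `⟪ν, x⟫` and its horizontal part is
`x - ⟪ν, x⟫ • ν`; only the values of `ϑ` on that hyperplane are used. -/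
structure IsLipschitzDomain {d : ℕ} (ω : Set (E d)) : Prop where
  isOpen : IsOpen ω
  isConnected : IsConnected ω
  lipschitz_boundary : ∀ z ∈ frontier ω,
    ∃ (ν : E d) (ϑ : E d → ℝ) (K : NNReal) (r : ℝ),
      ‖ν‖ = 1 ∧ LipschitzWith K ϑ ∧ 0 < r ∧
        ∀ x ∈ Metric.ball z r, x ∈ ω ↔ ϑ (x - inner ℝ ν x • ν) < inner ℝ ν x

/-- An unbounded Lipschitz domain with 1-periodic structure: membership in `ω` (equivalently, its
characteristic function) is 1-periodic. -/
structure IsReferenceDomain {d : ℕ} (ω : Set (E d)) : Prop extends IsLipschitzDomain ω where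
  unbounded : ¬ Bornology.IsBounded ω
  periodic : IsOnePeriodic fun x => x ∈ ω

/-- The structure conditions on the field `A(y, ξ)`: `C¹` regularity, strong monotonicity with
constant `μ₀` and Lipschitz continuity with constant `μ₁` in the second variable, 1-periodicity in
the first variable, and `A(y, 0) = 0`. -/
structure IsAdmissibleField {d : ℕ} (μ₀ μ₁ : ℝ) (A : E d → E d → E d) : Prop where
  contDiff : ContDiff ℝ 1 fun p : E d × E d => A p.1 p.2
  monotone : ∀ y ξ ξ', μ₀ * ‖ξ - ξ'‖ ^ 2 ≤ inner ℝ (A y ξ - A y ξ') (ξ - ξ')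
  growth : ∀ y ξ ξ', ‖A y ξ - A y ξ'‖ ≤ μ₁ * ‖ξ - ξ'‖
  periodic : ∀ ξ, IsOnePeriodic fun y => A y ξ
  map_zero : ∀ y, A y 0 = 0

/-- `G` is the weak gradient of `u` on the open set `U`: `∫_U u ∇φ = - ∫_U φ G` for all smooth
`φ` with compact support in `U`. -/
def HasWeakGradientOn {d : ℕ} (U : Set (E d)) (u : E d → ℝ) (G : E d → E d) : Prop :=
  ∀ φ : E d → ℝ, ContDiff ℝ (⊤ : ℕ∞) φ → HasCompactSupport φ → tsupport φ ⊆ U →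
    ∫ x in U, u x • gradient φ x = -∫ x in U, φ x • G x

/-- `u ∈ H¹(S)` with weak gradient `∇u = G`. -/
structure MemH1 {d : ℕ} (S : Set (E d)) (u : E d → ℝ) (G : E d → E d) : Prop where
  memLp : MemLp u 2 (volume.restrict S)
  memLp_grad : MemLp G 2 (volume.restrict S)
  weakGradient : HasWeakGradientOn (interior S) u G

/-- `u ∈ H¹_per(Y ∩ ω)` with weak gradient `∇u = G`: the function `u` lies in the closure, for the
norm of `H¹(Y ∩ ω)`, of the (restrictions of) smooth 1-periodic functions. -/
structure MemH1Per {d : ℕ} (ω : Set (E d)) (u : E d → ℝ) (G : E d → E d) : Prop extends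
    MemH1 (perforatedCell ω) u G where
  approx : ∀ ε : ℝ≥0∞, 0 < ε → ∃ φ : E d → ℝ, ContDiff ℝ (⊤ : ℕ∞) φ ∧ IsOnePeriodic φ ∧
    eLpNorm (fun y => u y - φ y) 2 (volume.restrict (perforatedCell ω)) < ε ∧
    eLpNorm (fun y => G y - gradient φ y) 2 (volume.restrict (perforatedCell ω)) < ε

/-- `N` is a corrector for the direction `ξ`, with `∇N = G`: a weak solution in `H¹_per(Y ∩ ω)`
with mean zero of `∇ · A(·, ξ + ∇N) = 0` in `Y ∩ ω`, with the natural (conormal) boundary condition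
`n · A(·, ξ + ∇N) = 0` on `Y ∩ ∂ω`. -/
structure IsCorrector {d : ℕ} (A : E d → E d → E d) (ω : Set (E d)) (ξ : E d)
    (N : E d → ℝ) (G : E d → E d) : Prop where
  memH1Per : MemH1Per ω N G
  mean_zero : ⨍ y in perforatedCell ω, N y = 0
  weak_eq : ∀ (v : E d → ℝ) (H : E d → E d), MemH1Per ω v H →
    ∫ y in perforatedCell ω, inner ℝ (A y (ξ + G y)) (H y) = 0

/-- The effective field `Â(ξ) = θ⁻¹ ∫_{Y ∩ ω} A(y, ξ + ∇N(y, ξ)) dy` with `θ = |Y ∩ ω|`, where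
`gradN ξ y` stands for `∇N(y, ξ)`. -/
noncomputable def effectiveField {d : ℕ} (A : E d → E d → E d) (ω : Set (E d))
    (gradN : E d → E d → E d) (ξ : E d) : E d :=
  (volume.real (perforatedCell ω))⁻¹ • ∫ y in perforatedCell ω, A y (ξ + gradN ξ y)

end PerforatedHomogenization

open PerforatedHomogenization

/-! ### Poincaré inequality on bounded pieces of `ω` for functions with periodic gradient. -/

namespace PerforatedHomogenization
open Set Metric
open scoped NNReal Topology

variable {d : ℕ}

/-! Write `p ξ = ξ + ∇N(·, ξ)` in `L²(Y ∩ ω)`. Testing the cell equations for `ξ` and `ξ'` with both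
correctors removes the gradient part of `p ξ - p ξ'`, so `⟨Â(ξ) - Â(ξ'), ξ - ξ'⟩ ≥ θ⁻¹ μ₀ ‖p ξ - p
ξ'‖²`. The Lipschitz bound follows from the same identity and Cauchy–Schwarz. Coercivity needs `‖η +
g‖² ≥ c |η|²` for every `g` in the closure of periodic gradients, with `c` depending only on `ω` and
`d` (`exists_mul_norm_sq_le`).

That inequality rests on `exists_poincare`. An affine function plus a periodic one has periodic
gradient; if its energy on the cell is small, it is close to a single constant on a large bounded
piece of `ω`. Its increment along the `i`-th unit vector is exactly `η i`, so `η` is small. Since `Y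
∩ ω` itself may be disconnected, the Poincaré inequality is proved by chaining translations through
`ω`, whose energy periodicity folds back into one cell.

Correctors come from a contraction argument in the space of gradients; the potential is then
recovered by Poincaré–Wirtinger. -/

lemma setLIntegral_comp_add_right (f : E d → ℝ≥0∞) (S : Set (E d)) (v : E d) :
    ∫⁻ x in (fun x => x + v) ⁻¹' S, f (x + v) = ∫⁻ x in S, f x :=
  (measurePreserving_add_right volume v).setLIntegral_comp_preimage_emb
    (MeasurableEquiv.addRight v).measurableEmbedding f S

lemma exists_add_latticeVec_mem_unitCell (x : E d) :
    ∃ k : Fin d → ℤ, (∀ i, |(k i : ℝ)| ≤ ‖x‖ + 1) ∧ x + latticeVec k ∈ unitCell d := by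
  refine ⟨fun i => -⌈x i - 1 / 2⌉, fun i => ?_, fun i => ?_⟩
  · have h1 := Int.le_ceil (x i - 1 / 2)
    have h2 := Int.ceil_lt_add_one (x i - 1 / 2)
    have h3 := abs_le.1 (PiLp.norm_apply_le x i)
    push_cast
    rw [abs_neg, abs_le]
    constructor <;> linarith [h3.1, h3.2]
  · have h1 := Int.le_ceil (x i - 1 / 2)
    have h2 := Int.ceil_lt_add_one (x i - 1 / 2)
    simp only [latticeVec, PiLp.add_apply, mem_Ioc]
    push_cast
    constructor <;> linarith

/-- Finitely many integer translates of the cell cover the ball, and each carries the same integral;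
`M` counts them. -/
lemma exists_setLIntegral_closedBall_le {ω : Set (E d)} (hω : IsOnePeriodic fun x => x ∈ ω)
    (R : ℝ) : ∃ M : ℝ≥0, ∀ f : E d → ℝ≥0∞, IsOnePeriodic f →
      ∫⁻ x in ω ∩ closedBall 0 R, f x ≤ M * ∫⁻ x in perforatedCell ω, f x := by
  obtain ⟨n, hn⟩ := exists_nat_ge (R + 1)
  let F : Finset (Fin d → ℤ) := Finset.Icc (fun _ => -(n : ℤ)) (fun _ => (n : ℤ))
  refine ⟨F.card, fun f hf => ?_⟩
  have hsub : ω ∩ closedBall 0 R ⊆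
      ⋃ k : F, (fun x => x + latticeVec k.1) ⁻¹' perforatedCell ω := by
    rintro x ⟨hx, hxR⟩
    obtain ⟨k, hk, hkx⟩ := exists_add_latticeVec_mem_unitCell x
    have hb : ∀ i, |k i| ≤ (n : ℤ) := fun i => by
      have := hk i
      rw [mem_closedBall_zero_iff] at hxR
      have h2 : |(k i : ℝ)| ≤ n := by linarith
      exact_mod_cast h2
    refine mem_iUnion.2 ⟨⟨k, Finset.mem_Icc.2 ⟨fun i => (abs_le.1 (hb i)).1,
      fun i => (abs_le.1 (hb i)).2⟩⟩, hkx, ?_⟩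
    have := hω k x
    simp only at this
    show x + latticeVec k ∈ ω
    rwa [this]
  calc ∫⁻ x in ω ∩ closedBall 0 R, f x
      ≤ ∫⁻ x in ⋃ k : F, (fun x => x + latticeVec k.1) ⁻¹' perforatedCell ω, f x :=
        lintegral_mono_set hsub
    _ ≤ ∑' k : F, ∫⁻ x in (fun x => x + latticeVec k.1) ⁻¹' perforatedCell ω, f x :=
        lintegral_iUnion_le _ _
    _ = ∑' _ : F, ∫⁻ x in perforatedCell ω, f x := by
        refine tsum_congr fun k => ?_
        rw [← setLIntegral_comp_add_right f (perforatedCell ω) (latticeVec k.1)]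
        simp only [hf k.1 _]
    _ = _ := by simp

lemma continuous_gradient {u : E d → ℝ} (hu : ContDiff ℝ 1 u) : Continuous (gradient u) :=
  (InnerProductSpace.toDual ℝ (E d)).symm.continuous.comp (hu.continuous_fderiv (by norm_num))

/-- Fundamental theorem of calculus along the segment, then monotonicity of `Lᵖ` norms on the
probability space `[0, 1]`. -/
lemma enorm_sq_sub_le {u : E d → ℝ} (hu : ContDiff ℝ 1 u) (x h : E d) :
    ‖u (x + h) - u x‖ₑ ^ 2 ≤ ‖h‖ₑ ^ 2 * ∫⁻ t in Icc (0 : ℝ) 1, ‖gradient u (x + t • h)‖ₑ ^ 2 := by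
  have hc : Continuous fun t : ℝ => gradient u (x + t • h) :=
    (continuous_gradient hu).comp (by fun_prop)
  have hd : ∀ t : ℝ, HasDerivAt (fun t : ℝ => u (x + t • h)) (inner ℝ (gradient u (x + t • h)) h) t := by
    intro t
    have h1 := (hu.differentiable (by norm_num) (x + t • h)).hasFDerivAt
    have h2 : HasDerivAt (fun t : ℝ => x + t • h) h t := by
      simpa using ((hasDerivAt_id t).smul_const h).const_add x
    have h3 := h1.comp_hasDerivAt t h2
    rwa [inner_gradient_left]
  have hFTC : u (x + h) - u x = ∫ t in Icc (0 : ℝ) 1, inner ℝ (gradient u (x + t • h)) h := by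
    have := intervalIntegral.integral_eq_sub_of_hasDerivAt (a := 0) (b := 1) (fun t _ => hd t)
      ((hc.inner continuous_const).intervalIntegrable _ _)
    rw [integral_Icc_eq_integral_Ioc, ← intervalIntegral.integral_of_le zero_le_one, this]
    simp
  have hprob : IsProbabilityMeasure (volume.restrict (Icc (0 : ℝ) 1)) := ⟨by simp⟩
  have h1 : ‖u (x + h) - u x‖ₑ ≤ ‖h‖ₑ * ∫⁻ t in Icc (0 : ℝ) 1, ‖gradient u (x + t • h)‖ₑ := by
    rw [hFTC, ← lintegral_const_mul' _ _ (by simp)]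
    refine (enorm_integral_le_lintegral_enorm _).trans (lintegral_mono fun t => ?_)
    rw [mul_comm]
    simp only [← ofReal_norm, ← ENNReal.ofReal_mul (norm_nonneg _)]
    exact ENNReal.ofReal_le_ofReal (norm_inner_le_norm _ _)
  have h2 : (∫⁻ t in Icc (0 : ℝ) 1, ‖gradient u (x + t • h)‖ₑ) ^ 2 ≤
      ∫⁻ t in Icc (0 : ℝ) 1, ‖gradient u (x + t • h)‖ₑ ^ 2 := by
    have := eLpNorm_le_eLpNorm_of_exponent_le (μ := volume.restrict (Icc (0 : ℝ) 1))
      (p := 1) (q := 2) (by norm_num) hc.aestronglyMeasurable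
    rw [eLpNorm_one_eq_lintegral_enorm] at this
    have h4 := pow_le_pow_left' this 2
    refine h4.trans (le_of_eq ?_)
    rw [eLpNorm_eq_lintegral_rpow_enorm_toReal (by norm_num) (by norm_num)]
    rw [← ENNReal.rpow_natCast, ← ENNReal.rpow_mul]
    norm_num
  calc _ ≤ (‖h‖ₑ * ∫⁻ t in Icc (0 : ℝ) 1, ‖gradient u (x + t • h)‖ₑ) ^ 2 := pow_le_pow_left' h1 2
    _ ≤ _ := by rw [mul_pow]; exact mul_le_mul_right h2 _

lemma setLIntegral_enorm_sq_sub_le {u : E d → ℝ} (hu : ContDiff ℝ 1 u) {S T : Set (E d)} {h : E d}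
    (hST : ∀ x ∈ S, ∀ t ∈ Icc (0 : ℝ) 1, x + t • h ∈ T) :
    ∫⁻ x in S, ‖u (x + h) - u x‖ₑ ^ 2 ≤ ‖h‖ₑ ^ 2 * ∫⁻ x in T, ‖gradient u x‖ₑ ^ 2 := by
  have hg := continuous_gradient hu
  calc ∫⁻ x in S, ‖u (x + h) - u x‖ₑ ^ 2
      ≤ ∫⁻ x in S, ‖h‖ₑ ^ 2 * ∫⁻ t in Icc (0 : ℝ) 1, ‖gradient u (x + t • h)‖ₑ ^ 2 :=
        lintegral_mono fun x => enorm_sq_sub_le hu x h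
    _ = ‖h‖ₑ ^ 2 * ∫⁻ t in Icc (0 : ℝ) 1, ∫⁻ x in S, ‖gradient u (x + t • h)‖ₑ ^ 2 := by
        rw [lintegral_const_mul' _ _ (by simp), lintegral_lintegral_swap]
        refine Continuous.aemeasurable ?_
        have : Continuous fun p : E d × ℝ => gradient u (p.1 + p.2 • h) := hg.comp (by fun_prop)
        exact (ENNReal.continuous_pow 2).comp this.enorm
    _ ≤ ‖h‖ₑ ^ 2 * ∫⁻ t in Icc (0 : ℝ) 1, ∫⁻ x in T, ‖gradient u x‖ₑ ^ 2 := by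
        refine mul_le_mul_right ?_ _
        refine setLIntegral_mono' (measurableSet_Icc (α := ℝ)) fun t ht => ?_
        rw [← setLIntegral_comp_add_right _ T (t • h)]
        exact lintegral_mono_set fun x hx => hST x hx t ht
    _ = _ := by simp

lemma enorm_sub_sq_le (a b c : ℝ) :
    ‖a - c‖ₑ ^ 2 ≤ 2 * (‖b - a‖ₑ ^ 2 + ‖b - c‖ₑ ^ 2) := by
  have hr : ‖a - c‖ ^ 2 ≤ 2 * (‖b - a‖ ^ 2 + ‖b - c‖ ^ 2) := by
    simp only [Real.norm_eq_abs, sq_abs]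
    nlinarith [sq_nonneg (b - a + (b - c))]
  have := ENNReal.ofReal_le_ofReal hr
  rw [ENNReal.ofReal_mul (by norm_num), ENNReal.ofReal_add (by positivity) (by positivity)] at this
  simpa only [ENNReal.ofReal_pow (norm_nonneg _), ofReal_norm, ENNReal.ofReal_ofNat] using this

/-- The deviation of `u` from a constant on `S` is controlled by the energy of `u` on the
perforated cell and by the deviation on `B`, uniformly among the functions `u` with periodic
gradient. -/
def DeviationControlled (ω B S : Set (E d)) : Prop :=
  ∃ C : ℝ≥0, ∀ u : E d → ℝ, ContDiff ℝ 1 u → IsOnePeriodic (gradient u) → ∀ c : ℝ,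
    ∫⁻ x in S, ‖u x - c‖ₑ ^ 2 ≤
      C * ((∫⁻ x in perforatedCell ω, ‖gradient u x‖ₑ ^ 2) + ∫⁻ x in B, ‖u x - c‖ₑ ^ 2)

namespace DeviationControlled
variable {ω B S T : Set (E d)}

lemma refl (ω B : Set (E d)) : DeviationControlled ω B B :=
  ⟨1, fun u _ _ c => by simp⟩

lemma empty (ω B : Set (E d)) : DeviationControlled ω B ∅ :=
  ⟨0, fun u _ _ c => by simp⟩

lemma mono (h : DeviationControlled ω B T) (hST : S ⊆ T) : DeviationControlled ω B S := by
  obtain ⟨C, hC⟩ := h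
  exact ⟨C, fun u hu hp c => (lintegral_mono_set hST).trans (hC u hu hp c)⟩

lemma union (hS : DeviationControlled ω B S) (hT : DeviationControlled ω B T) :
    DeviationControlled ω B (S ∪ T) := by
  obtain ⟨C, hC⟩ := hS
  obtain ⟨D, hD⟩ := hT
  refine ⟨C + D, fun u hu hp c => (lintegral_union_le _ _ _).trans ?_⟩
  rw [ENNReal.coe_add, add_mul]
  exact add_le_add (hC u hu hp c) (hD u hu hp c)

/-- The propagation step: `u x - c` splits into the increment from `x` to `x + h`, paid for by the
energy along segments inside `ω`, and the deviation on `T`. The same `c` occurs on both sides, so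
such steps can be chained. -/
lemma of_translate (hω : IsOnePeriodic fun x => x ∈ ω) {h : E d}
    (hT : DeviationControlled ω B T) (hST : ∀ x ∈ S, x + h ∈ T)
    (hseg : ∀ x ∈ S, ∀ t ∈ Icc (0 : ℝ) 1, x + t • h ∈ ω) (hS : Bornology.IsBounded S) :
    DeviationControlled ω B S := by
  obtain ⟨R, hR⟩ := hS.subset_closedBall 0
  obtain ⟨M, hM⟩ := exists_setLIntegral_closedBall_le hω (R + ‖h‖)
  obtain ⟨C, hC⟩ := hT
  refine ⟨2 * (‖h‖₊ ^ 2 * M + C), fun u hu hp c => ?_⟩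
  set G := ∫⁻ x in perforatedCell ω, ‖gradient u x‖ₑ ^ 2
  set D := ∫⁻ x in B, ‖u x - c‖ₑ ^ 2
  have h1 : ∫⁻ x in S, ‖u (x + h) - u x‖ₑ ^ 2 ≤ ‖h‖ₑ ^ 2 * (M * G) := by
    refine (setLIntegral_enorm_sq_sub_le hu (T := ω ∩ closedBall 0 (R + ‖h‖)) ?_).trans ?_
    · intro x hx t ht
      refine ⟨hseg x hx t ht, ?_⟩
      have h2 := hR hx
      rw [mem_closedBall_zero_iff] at h2 ⊢
      refine (norm_add_le _ _).trans (add_le_add h2 ?_)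
      rw [norm_smul, Real.norm_of_nonneg ht.1]
      exact mul_le_of_le_one_left (norm_nonneg _) ht.2
    · gcongr
      exact hM _ fun k y => by simp only [hp k y]
  have h2 : ∫⁻ x in S, ‖u (x + h) - c‖ₑ ^ 2 ≤ C * (G + D) := by
    refine le_trans ?_ (hC u hu hp c)
    rw [← setLIntegral_comp_add_right _ T h]
    exact lintegral_mono_set hST
  calc ∫⁻ x in S, ‖u x - c‖ₑ ^ 2
      ≤ ∫⁻ x in S, 2 * (‖u (x + h) - u x‖ₑ ^ 2 + ‖u (x + h) - c‖ₑ ^ 2) :=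
        lintegral_mono fun x => enorm_sub_sq_le _ _ _
    _ = 2 * ((∫⁻ x in S, ‖u (x + h) - u x‖ₑ ^ 2) + ∫⁻ x in S, ‖u (x + h) - c‖ₑ ^ 2) := by
        rw [lintegral_const_mul' _ _ (by simp), lintegral_add_left']
        have := hu.continuous
        exact ((ENNReal.continuous_pow 2).comp
          (by fun_prop : Continuous fun x => ‖u (x + h) - u x‖ₑ)).aemeasurable
    _ ≤ 2 * (‖h‖ₑ ^ 2 * (M * G) + C * (G + D)) := by gcongr
    _ ≤ 2 * (‖h‖ₑ ^ 2 * (M * (G + D)) + C * (G + D)) := by gcongr; exact le_self_add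
    _ = _ := by push_cast; rw [enorm_eq_nnnorm]; ring

/-- The points having a controlled ball form an open set that is relatively closed in `ω`: near a
limit point `y`, translating by `w - y` towards a good point `w` stays in a ball contained in `ω`.
Connectedness of `ω` concludes. -/
lemma exists_ball (hω : IsReferenceDomain ω) {x₀ : E d} (hx₀ : x₀ ∈ ω) {r₀ : ℝ} (hr₀ : 0 < r₀)
    {x : E d} (hx : x ∈ ω) : ∃ r > 0, DeviationControlled ω (ball x₀ r₀) (ball x r) := by
  set W : Set (E d) := {x | ∃ r > 0, DeviationControlled ω (ball x₀ r₀) (ball x r)}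
  have hWo : IsOpen W := by
    rw [Metric.isOpen_iff]
    rintro x ⟨r, hr, h⟩
    refine ⟨r / 2, half_pos hr, fun y hy => ⟨r / 2, half_pos hr, h.mono ?_⟩⟩
    refine ball_subset_ball' ?_
    rw [mem_ball] at hy
    linarith
  refine hω.isConnected.isPreconnected.subset_of_closure_inter_subset hWo
    ⟨x₀, hx₀, r₀, hr₀, refl _ _⟩ ?_ hx
  rintro y ⟨hyW, hy⟩
  obtain ⟨ρ, hρ, hρω⟩ := Metric.isOpen_iff.1 hω.isOpen y hy
  obtain ⟨w, ⟨r, hr, hw⟩, hyw⟩ := Metric.mem_closure_iff.1 hyW (ρ / 2) (half_pos hρ)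
  refine ⟨min r (ρ / 2), lt_min hr (half_pos hρ), of_translate hω.periodic
    (h := w - y) (hw.mono (ball_subset_ball (min_le_left r (ρ / 2)))) ?_ ?_ isBounded_ball⟩
  · intro x hx
    rw [mem_ball, dist_eq_norm] at hx ⊢
    rwa [show x + (w - y) - w = x - y by abel]
  · intro x hx t ht
    apply hρω
    rw [mem_ball, dist_eq_norm] at hx ⊢
    rw [show x + t • (w - y) - y = (x - y) + t • (w - y) by abel]
    have h1 : ‖t • (w - y)‖ ≤ ‖w - y‖ := by
      rw [norm_smul, Real.norm_of_nonneg ht.1]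
      exact mul_le_of_le_one_left (norm_nonneg _) ht.2
    rw [dist_comm, dist_eq_norm] at hyw
    linarith [norm_add_le (x - y) (t • (w - y)), min_le_right r (ρ / 2)]

lemma of_isCompact (hω : IsReferenceDomain ω) {x₀ : E d} (hx₀ : x₀ ∈ ω) {r₀ : ℝ} (hr₀ : 0 < r₀)
    {K : Set (E d)} (hK : IsCompact K) (hKω : K ⊆ ω) :
    DeviationControlled ω (ball x₀ r₀) K := by
  refine hK.induction_on (empty _ _) (fun _ _ h h' => h'.mono h) (fun _ _ => union) ?_
  intro x hx
  obtain ⟨r, hr, h⟩ := exists_ball hω hx₀ hr₀ (hKω hx)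
  exact ⟨_, mem_nhdsWithin_of_mem_nhds (ball_mem_nhds x hr), h⟩

/-- Moving up by `(r / 4) • ν` keeps points above the graph and carries the boundary piece into a
compact subset of `ω`, which is already controlled. -/
lemma exists_ball_of_mem_frontier (hω : IsReferenceDomain ω) {x₀ : E d} (hx₀ : x₀ ∈ ω)
    {r₀ : ℝ} (hr₀ : 0 < r₀) {z : E d} (hz : z ∈ frontier ω) :
    ∃ r > 0, DeviationControlled ω (ball x₀ r₀) (ω ∩ ball z r) := by
  obtain ⟨ν, ϑ, K, r, hν, hϑ, hr, hgraph⟩ := hω.lipschitz_boundary z hz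
  have hνν : inner ℝ ν ν = (1 : ℝ) := by rw [real_inner_self_eq_norm_sq, hν]; norm_num
  have hhor : ∀ (x : E d) (s : ℝ),
      (x + s • ν) - inner ℝ ν (x + s • ν) • ν = x - inner ℝ ν x • ν := by
    intro x s
    rw [inner_add_right, inner_smul_right, hνν, add_smul, mul_one]
    abel
  have hver : ∀ (x : E d) (s : ℝ), inner ℝ ν (x + s • ν) = inner ℝ ν x + s := by
    intro x s
    rw [inner_add_right, inner_smul_right, hνν, mul_one]
  have hc := hϑ.continuous
  -- The height gap `r / 4` equals the length of the upward shift, and `r / 4 + r / 4 = r / 2` keeps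
  -- shifted points in this ball.
  set Kc : Set (E d) := closedBall z (r / 2) ∩
    {y | ϑ (y - inner ℝ ν y • ν) ≤ inner ℝ ν y - r / 4}
  have hKc : IsCompact Kc := (isCompact_closedBall _ _).inter_right <|
    isClosed_le (hc.comp (by fun_prop)) (by fun_prop)
  have hKω : Kc ⊆ ω := by
    rintro y ⟨hy, hy'⟩
    refine (hgraph y (closedBall_subset_ball (by linarith) hy)).2 ?_
    simp only [mem_ofPred_eq] at hy'
    linarith
  have hball : ∀ x ∈ ball z (r / 4), ∀ s ∈ Icc (0 : ℝ) (r / 4), x + s • ν ∈ closedBall z (r / 2) := by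
    intro x hx s hs
    rw [mem_closedBall, dist_eq_norm, show x + s • ν - z = (x - z) + s • ν by abel]
    rw [mem_ball, dist_eq_norm] at hx
    have : ‖s • ν‖ ≤ r / 4 := by rw [norm_smul, hν, mul_one, Real.norm_of_nonneg hs.1]; exact hs.2
    linarith [norm_add_le (x - z) (s • ν)]
  have hgr : ∀ x ∈ ω ∩ ball z (r / 4), ϑ (x - inner ℝ ν x • ν) < inner ℝ ν x := fun x hx =>
    (hgraph x (ball_subset_ball (by linarith) hx.2)).1 hx.1
  refine ⟨r / 4, by positivity, of_translate hω.periodic (h := (r / 4) • ν)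
    (of_isCompact hω hx₀ hr₀ hKc hKω) ?_ ?_ (isBounded_ball.subset inter_subset_right)⟩
  · intro x hx
    refine ⟨hball x hx.2 _ ⟨by positivity, le_rfl⟩, ?_⟩
    simp only [mem_ofPred_eq]
    rw [hhor, hver]
    linarith [hgr x hx]
  · intro x hx t ht
    rw [smul_smul]
    have h0 : 0 ≤ t * (r / 4) := mul_nonneg ht.1 (by positivity)
    refine (hgraph _ (closedBall_subset_ball (by linarith) (hball x hx.2 _ ⟨h0, ?_⟩))).2 ?_
    · exact mul_le_of_le_one_left (by positivity) ht.2
    · rw [hhor, hver]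
      linarith [hgr x hx]

lemma inter_closedBall (hω : IsReferenceDomain ω) {x₀ : E d} (hx₀ : x₀ ∈ ω)
    {r₀ : ℝ} (hr₀ : 0 < r₀) (R : ℝ) :
    DeviationControlled ω (ball x₀ r₀) (ω ∩ closedBall 0 R) := by
  refine (isCompact_closedBall (0 : E d) R).induction_on
    (p := fun S => DeviationControlled ω (ball x₀ r₀) (ω ∩ S)) (by simpa using empty _ _)
    (fun _ _ h h' => h'.mono (inter_subset_inter_right _ h))
    (fun _ _ h h' => by rw [inter_union_distrib_left]; exact h.union h') ?_
  intro x _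
  suffices ∃ t ∈ 𝓝 x, DeviationControlled ω (ball x₀ r₀) (ω ∩ t) from
    let ⟨t, ht, h⟩ := this
    ⟨t, mem_nhdsWithin_of_mem_nhds ht, h⟩
  by_cases hx : x ∈ ω
  · obtain ⟨r, hr, h⟩ := exists_ball hω hx₀ hr₀ hx
    exact ⟨_, ball_mem_nhds x hr, h.mono inter_subset_right⟩
  by_cases hx' : x ∈ closure ω
  · obtain ⟨r, hr, h⟩ := exists_ball_of_mem_frontier hω hx₀ hr₀
      (z := x) ⟨hx', fun h => hx (interior_subset h)⟩
    exact ⟨_, ball_mem_nhds x hr, h⟩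
  · refine ⟨(closure ω)ᶜ, isClosed_closure.isOpen_compl.mem_nhds hx', (empty _ _).mono ?_⟩
    rintro y ⟨hy, hy'⟩
    exact hy' (subset_closure hy)

end DeviationControlled

lemma exists_poincare_ball {ω : Set (E d)} (hω : IsOnePeriodic fun x => x ∈ ω)
    {x₀ : E d} {r : ℝ} (hr : 0 < r) (hB : ball x₀ r ⊆ ω) :
    ∃ C : ℝ≥0, ∀ u : E d → ℝ, ContDiff ℝ 1 u → IsOnePeriodic (gradient u) → ∃ c : ℝ,
      ∫⁻ x in ball x₀ r, ‖u x - c‖ₑ ^ 2 ≤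
        C * ∫⁻ x in perforatedCell ω, ‖gradient u x‖ₑ ^ 2 := by
  obtain ⟨M, hM⟩ := exists_setLIntegral_closedBall_le hω (‖x₀‖ + r)
  set B := ball x₀ r
  have hBm : MeasurableSet B := measurableSet_ball
  have hB0 : volume B ≠ 0 := (measure_ball_pos volume x₀ hr).ne'
  have hBt : volume B ≠ ∞ := measure_ball_lt_top.ne
  set κ : ℝ≥0∞ := (volume B)⁻¹ * (volume (ball (0 : E d) (2 * r)) *
    (ENNReal.ofReal (2 * r) ^ 2 * M))
  have hκ : κ ≠ ∞ := by
    refine ENNReal.mul_ne_top (ENNReal.inv_ne_top.2 hB0) (ENNReal.mul_ne_top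
      measure_ball_lt_top.ne (ENNReal.mul_ne_top (ENNReal.pow_ne_top ENNReal.ofReal_ne_top) (by simp)))
  refine ⟨κ.toNNReal, fun u hu hp => ?_⟩
  rw [ENNReal.coe_toNNReal hκ]
  set G := ∫⁻ x in perforatedCell ω, ‖gradient u x‖ₑ ^ 2
  have huc := hu.continuous
  have hm : Measurable fun p : E d × E d => ‖u p.2 - u p.1‖ₑ ^ 2 :=
    ((ENNReal.continuous_pow 2).comp
      (by fun_prop : Continuous fun p : E d × E d => ‖u p.2 - u p.1‖ₑ)).measurable
  set F : E d × E d → ℝ≥0∞ := (B ×ˢ B).indicator fun p => ‖u p.2 - u p.1‖ₑ ^ 2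
  have hF : Measurable F := hm.indicator (hBm.prod hBm)
  -- Substituting `y = x + h` leaves only `‖h‖ < 2 * r`; by convexity of the ball each segment stays
  -- in `B ⊆ ω`.
  have hdouble : ∫⁻ x in B, ∫⁻ y in B, ‖u y - u x‖ₑ ^ 2 ≤
      volume (ball (0 : E d) (2 * r)) * (ENNReal.ofReal (2 * r) ^ 2 * (M * G)) := by
    calc ∫⁻ x in B, ∫⁻ y in B, ‖u y - u x‖ₑ ^ 2
        = ∫⁻ x, ∫⁻ y, F (x, y) := by
          rw [← lintegral_indicator hBm]
          refine lintegral_congr fun x => ?_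
          by_cases hx : x ∈ B
          · rw [indicator_of_mem hx, ← lintegral_indicator hBm]
            refine lintegral_congr fun y => ?_
            by_cases hy : y ∈ B <;> simp [F, hx, hy]
          · simp [F, hx]
      _ = ∫⁻ x, ∫⁻ h, F (x, x + h) := by
          refine lintegral_congr fun x => ?_
          exact (lintegral_add_left_eq_self (fun y => F (x, y)) x).symm
      _ = ∫⁻ h, ∫⁻ x, F (x, x + h) := by
          rw [lintegral_lintegral_swap]
          exact (hF.comp (by fun_prop)).aemeasurable
      _ ≤ ∫⁻ h, (ball (0 : E d) (2 * r)).indicator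
            (fun _ => ENNReal.ofReal (2 * r) ^ 2 * (M * G)) h := by
          refine lintegral_mono fun h => ?_
          by_cases hh : h ∈ ball (0 : E d) (2 * r)
          · rw [indicator_of_mem hh]
            have h1 : ∫⁻ x, F (x, x + h) ≤
                ∫⁻ x in {x | x ∈ B ∧ x + h ∈ B}, ‖u (x + h) - u x‖ₑ ^ 2 := by
              have hms : MeasurableSet {x | x ∈ B ∧ x + h ∈ B} :=
                hBm.inter (hBm.preimage (measurable_add_const h))
              rw [← lintegral_indicator hms]
              refine lintegral_mono fun x => ?_
              by_cases hx : x ∈ B ∧ x + h ∈ B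
              · simp [F, hx.1, hx.2]
              · have : (x, x + h) ∉ B ×ˢ B := hx
                simp [F, this]
            refine h1.trans ((setLIntegral_enorm_sq_sub_le hu (T := ω ∩ closedBall 0 (‖x₀‖ + r))
              ?_).trans ?_)
            · rintro x ⟨hx, hxh⟩ t ht
              have hmem : x + t • h ∈ B := by
                have := (convex_ball x₀ r) hx hxh (sub_nonneg.2 ht.2) ht.1 (by ring)
                convert this using 1
                module
              refine ⟨hB hmem, ?_⟩
              rw [mem_closedBall_zero_iff]
              have h3 : ‖x + t • h - x₀‖ < r := by rw [← dist_eq_norm]; exact hmem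
              have h4 := norm_add_le x₀ (x + t • h - x₀)
              rw [add_sub_cancel] at h4
              linarith
            · gcongr
              · rw [← ofReal_norm]
                exact ENNReal.ofReal_le_ofReal (mem_ball_zero_iff.1 hh).le
              · exact hM _ fun k y => by simp only [hp k y]
          · rw [indicator_of_notMem hh]
            refine le_of_eq ?_
            rw [← lintegral_zero (μ := (volume : Measure (E d)))]
            refine lintegral_congr fun x => ?_
            have : (x, x + h) ∉ B ×ˢ B := by
              rintro ⟨hx, hxh⟩
              apply hh
              simp only [B, mem_ball, dist_eq_norm, sub_zero] at hx hxh ⊢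
              have := norm_sub_le (x + h - x₀) (x - x₀)
              rw [show x + h - x₀ - (x - x₀) = h by abel] at this
              linarith
            simp [F, this]
      _ = _ := by rw [lintegral_indicator measurableSet_ball]; simp [mul_comm]
  -- Some `x` in `B` has inner integral at most the average; `c = u x` is then a suitable constant.
  obtain ⟨x, _, hx⟩ := exists_le_setLAverage hB0 hBt
    (f := fun x => ∫⁻ y in B, ‖u y - u x‖ₑ ^ 2)
    (Measurable.lintegral_prod_right' hm).aemeasurable
  refine ⟨u x, hx.trans ?_⟩
  rw [setLAverage_eq, ENNReal.div_eq_inv_mul]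
  calc _ ≤ (volume B)⁻¹ * (volume (ball (0 : E d) (2 * r)) *
        (ENNReal.ofReal (2 * r) ^ 2 * (M * G))) := by gcongr
    _ = _ := by simp only [κ]; ring

/-- Poincaré inequality for functions with periodic gradient. -/
theorem exists_poincare {ω : Set (E d)} (hω : IsReferenceDomain ω) (R : ℝ) :
    ∃ C : ℝ≥0, ∀ u : E d → ℝ, ContDiff ℝ 1 u → IsOnePeriodic (gradient u) → ∃ c : ℝ,
      ∫⁻ x in ω ∩ closedBall 0 R, ‖u x - c‖ₑ ^ 2 ≤
        C * ∫⁻ x in perforatedCell ω, ‖gradient u x‖ₑ ^ 2 := by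
  obtain ⟨x₀, hx₀⟩ := hω.isConnected.nonempty
  obtain ⟨r, hr, hrω⟩ := Metric.isOpen_iff.1 hω.isOpen x₀ hx₀
  obtain ⟨C, hC⟩ := exists_poincare_ball hω.periodic hr hrω
  obtain ⟨D, hD⟩ := DeviationControlled.inter_closedBall hω hx₀ hr R
  refine ⟨D * (1 + C), fun u hu hp => ?_⟩
  obtain ⟨c, hc⟩ := hC u hu hp
  refine ⟨c, (hD u hu hp c).trans ?_⟩
  push_cast
  rw [mul_assoc, add_mul, one_mul]
  gcongr

end PerforatedHomogenization

/-! ### Consequences on the cell: positive definiteness and Poincaré–Wirtinger. -/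

namespace PerforatedHomogenization
open Set Metric
open scoped NNReal Topology

variable {d : ℕ} {ω : Set (E d)}

lemma norm_le_of_mem_unitCell {x : E d} (hx : x ∈ unitCell d) : ‖x‖ ≤ √d := by
  rw [EuclideanSpace.norm_eq]
  refine Real.sqrt_le_sqrt ?_
  calc ∑ i, ‖x i‖ ^ 2 ≤ ∑ _ : Fin d, (1 : ℝ) := by
        refine Finset.sum_le_sum fun i _ => ?_
        rw [Real.norm_eq_abs, sq_abs]
        nlinarith [(hx i).1, (hx i).2]
    _ = d := by simp

lemma measurableSet_perforatedCell (hω : IsOpen ω) : MeasurableSet (perforatedCell ω) := by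
  refine MeasurableSet.inter ?_ hω.measurableSet
  have : unitCell d = ⋂ i, (fun y : E d => y i) ⁻¹' Ioc (-(1 / 2) : ℝ) (1 / 2) := by
    ext; simp [unitCell]
  rw [this]
  exact MeasurableSet.iInter fun i => measurableSet_Ioc.preimage
    (by fun_prop : Continuous fun y : E d => y i).measurable

lemma perforatedCell_subset_closedBall (ω : Set (E d)) :
    perforatedCell ω ⊆ closedBall 0 (√d) := fun _ hx =>
  mem_closedBall_zero_iff.2 (norm_le_of_mem_unitCell hx.1)

lemma volume_perforatedCell_ne_top (ω : Set (E d)) : volume (perforatedCell ω) ≠ ∞ :=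
  (measure_mono (perforatedCell_subset_closedBall ω)).trans_lt measure_closedBall_lt_top |>.ne

instance (ω : Set (E d)) : IsFiniteMeasure (volume.restrict (perforatedCell ω)) :=
  ⟨by simpa using (volume_perforatedCell_ne_top ω).lt_top⟩

/-- Translates of a null cell would cover every bounded part of `ω` by null sets, yet `ω` contains a
ball. -/
lemma volume_perforatedCell_ne_zero (hω : IsReferenceDomain ω) :
    volume (perforatedCell ω) ≠ 0 := by
  intro h0
  obtain ⟨x, hx⟩ := hω.isConnected.nonempty
  obtain ⟨r, hr, hrω⟩ := Metric.isOpen_iff.1 hω.isOpen x hx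
  obtain ⟨M, hM⟩ := exists_setLIntegral_closedBall_le hω.periodic (‖x‖ + r)
  have h1 := hM (fun _ => 1) (fun _ _ => rfl)
  simp only [lintegral_const, one_mul, Measure.restrict_apply_univ, h0, mul_zero] at h1
  have h2 : ball x r ⊆ ω ∩ closedBall 0 (‖x‖ + r) := fun y hy => ⟨hrω hy, by
    rw [mem_ball, dist_eq_norm] at hy
    rw [mem_closedBall_zero_iff]
    have := norm_add_le x (y - x)
    rw [add_sub_cancel] at this
    linarith⟩
  exact (measure_ball_pos volume x hr).ne' (measure_mono_null h2 (nonpos_iff_eq_zero.1 h1))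

lemma IsOnePeriodic.gradient {φ : E d → ℝ} (h : IsOnePeriodic φ) :
    IsOnePeriodic (gradient φ) := by
  intro k y
  have h1 : (fun x => φ (x + latticeVec k)) = φ := funext (h k)
  have h2 := fderiv_comp_add_right (𝕜 := ℝ) (f := φ) (x := y) (latticeVec k)
  rw [h1] at h2
  simp only [_root_.gradient, h2]

lemma latticeVec_single (i : Fin d) :
    (latticeVec (Pi.single i 1) : E d) = EuclideanSpace.single i (1 : ℝ) := by
  ext j
  by_cases h : j = i
  · subst h; simp [latticeVec]
  · simp [latticeVec, h]

lemma gradient_add_inner {φ : E d → ℝ} (hφ : Differentiable ℝ φ) (η x : E d) :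
    gradient (fun y => φ y + inner ℝ η y) x = η + gradient φ x := by
  refine HasGradientAt.gradient ?_
  rw [hasGradientAt_iff_hasFDerivAt]
  have h1 := (hφ x).hasFDerivAt.add (innerSL ℝ η).hasFDerivAt
  have h2 : InnerProductSpace.toDual ℝ (E d) (η + gradient φ x) =
      fderiv ℝ φ x + innerSL ℝ η := by
    ext v
    simp [add_comm]
  rw [h2]
  exact h1

/-- Positive definiteness of the energy of affine functions with a periodic correction. -/
theorem exists_enorm_sq_le_setLIntegral (hω : IsReferenceDomain ω) :
    ∃ C : ℝ≥0, ∀ φ : E d → ℝ, ContDiff ℝ 1 φ → IsOnePeriodic φ → ∀ η : E d,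
      ‖η‖ₑ ^ 2 ≤ C * ∫⁻ x in perforatedCell ω, ‖η + gradient φ x‖ₑ ^ 2 := by
  -- This radius contains the cell and its translates by unit coordinate vectors.
  obtain ⟨C, hC⟩ := exists_poincare hω (√d + 1)
  have hθ := volume_perforatedCell_ne_zero hω
  set θ := volume (perforatedCell ω) with hθdef
  set κ : ℝ≥0∞ := d * (θ⁻¹ * (4 * C))
  have hκ : κ ≠ ∞ := ENNReal.mul_ne_top (by simp)
    (ENNReal.mul_ne_top (ENNReal.inv_ne_top.2 hθ) (ENNReal.mul_ne_top (by simp) (by simp)))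
  refine ⟨κ.toNNReal, fun φ hφ hper η => ?_⟩
  rw [ENNReal.coe_toNNReal hκ]
  set u : E d → ℝ := fun y => φ y + inner ℝ η y
  have hu : ContDiff ℝ 1 u := hφ.add (contDiff_const.inner ℝ contDiff_id)
  have hgrad : gradient u = fun x => η + gradient φ x :=
    funext fun x => gradient_add_inner (hφ.differentiable (by norm_num)) η x
  obtain ⟨c, hc⟩ := hC u hu fun k y => by simp only [hgrad, hper.gradient k y]
  rw [hgrad] at hc
  set G := ∫⁻ x in perforatedCell ω, ‖η + gradient φ x‖ₑ ^ 2
  -- `η i = u (x + e) - u x` for every `x`, and one constant `c` approximates `u` on the cell and on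
  -- its translate.
  have hi : ∀ i, ‖η i‖ₑ ^ 2 ≤ θ⁻¹ * (4 * C) * G := by
    intro i
    set e : E d := latticeVec (Pi.single i 1)
    have hnorm : ‖e‖ = 1 := by simp [e, latticeVec_single]
    have h1 : ∫⁻ x in perforatedCell ω, ‖c - u x‖ₑ ^ 2 ≤ C * G := by
      refine le_trans ?_ hc
      simp only [enorm_sub_rev c]
      refine lintegral_mono_set (subset_inter inter_subset_right ?_)
      exact (perforatedCell_subset_closedBall ω).trans (closedBall_subset_closedBall (by linarith))
    have h2 : ∫⁻ x in perforatedCell ω, ‖c - u (x + e)‖ₑ ^ 2 ≤ C * G := by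
      refine le_trans ?_ hc
      simp only [enorm_sub_rev c]
      rw [← setLIntegral_comp_add_right _ (ω ∩ closedBall 0 (√d + 1)) e]
      rw [preimage_inter]
      refine lintegral_mono_set (subset_inter (fun x hx => ?_) fun x hx => ?_)
      · have := hω.periodic (Pi.single i 1) x
        simp only at this
        show x + e ∈ ω
        rw [this]
        exact hx.2
      · have := norm_le_of_mem_unitCell hx.1
        rw [mem_preimage, mem_closedBall_zero_iff]
        linarith [norm_add_le x e]
    have h3 : ∀ x, ‖η i‖ₑ ^ 2 ≤ 2 * (‖c - u (x + e)‖ₑ ^ 2 + ‖c - u x‖ₑ ^ 2) := by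
      intro x
      have : η i = u (x + e) - u x := by
        simp only [u, inner_add_right, e, hper _ x]
        rw [latticeVec_single, EuclideanSpace.inner_single_right]
        simp
      rw [this]
      exact enorm_sub_sq_le _ _ _
    have h4 : θ * ‖η i‖ₑ ^ 2 ≤ 4 * C * G := by
      calc θ * ‖η i‖ₑ ^ 2 = ∫⁻ x in perforatedCell ω, ‖η i‖ₑ ^ 2 := by simp [hθdef, mul_comm]
        _ ≤ ∫⁻ x in perforatedCell ω, 2 * (‖c - u (x + e)‖ₑ ^ 2 + ‖c - u x‖ₑ ^ 2) :=
          lintegral_mono h3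
        _ = 2 * ((∫⁻ x in perforatedCell ω, ‖c - u (x + e)‖ₑ ^ 2) +
              ∫⁻ x in perforatedCell ω, ‖c - u x‖ₑ ^ 2) := by
          rw [lintegral_const_mul' _ _ (by simp), lintegral_add_left']
          have := hu.continuous
          exact ((ENNReal.continuous_pow 2).comp
            (by fun_prop : Continuous fun x => ‖c - u (x + e)‖ₑ)).aemeasurable
        _ ≤ 2 * (C * G + C * G) := by gcongr
        _ = 4 * C * G := by ring
    calc ‖η i‖ₑ ^ 2 = θ⁻¹ * (θ * ‖η i‖ₑ ^ 2) := by
          rw [← mul_assoc, ENNReal.inv_mul_cancel hθ (volume_perforatedCell_ne_top ω), one_mul]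
      _ ≤ θ⁻¹ * (4 * C * G) := by gcongr
      _ = _ := by ring
  have hsum : ‖η‖ₑ ^ 2 = ∑ i, ‖η i‖ₑ ^ 2 := by
    simp only [← ofReal_norm, ← ENNReal.ofReal_pow (norm_nonneg _)]
    rw [EuclideanSpace.norm_sq_eq, ENNReal.ofReal_sum_of_nonneg fun i _ => by positivity]
  rw [hsum]
  calc _ ≤ ∑ _ : Fin d, θ⁻¹ * (4 * C) * G := Finset.sum_le_sum fun i _ => hi i
    _ = _ := by simp [κ]; ring

lemma _root_.Continuous.memLp_perforatedCell {F : Type*} [NormedAddCommGroup F]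
    [SecondCountableTopologyEither (E d) F] {f : E d → F}
    (hf : Continuous f) (hω : IsOpen ω) (p : ℝ≥0∞) :
    MemLp f p (volume.restrict (perforatedCell ω)) := by
  obtain ⟨C, hC⟩ := (isCompact_closedBall (0 : E d) (√d)).exists_bound_of_continuousOn
    hf.continuousOn
  refine MemLp.of_bound hf.aestronglyMeasurable C ?_
  filter_upwards [ae_restrict_mem (measurableSet_perforatedCell hω)] with x hx
  exact hC x (perforatedCell_subset_closedBall ω hx)

lemma eLpNorm_two_sq {α F : Type*} [MeasurableSpace α] [NormedAddCommGroup F] (f : α → F)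
    (μ : Measure α) : eLpNorm f 2 μ ^ 2 = ∫⁻ x, ‖f x‖ₑ ^ 2 ∂μ := by
  rw [eLpNorm_eq_lintegral_rpow_enorm_toReal (by norm_num) (by norm_num),
    ← ENNReal.rpow_natCast, ← ENNReal.rpow_mul]
  norm_num

/-- Poincaré–Wirtinger inequality on the perforated cell for periodic functions. -/
theorem exists_eLpNorm_le_eLpNorm_gradient (hω : IsReferenceDomain ω) :
    ∃ K : ℝ≥0, ∀ φ : E d → ℝ, ContDiff ℝ 1 φ → IsOnePeriodic φ →
      ∫ x in perforatedCell ω, φ x = 0 →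
      eLpNorm φ 2 (volume.restrict (perforatedCell ω)) ≤
        K * eLpNorm (gradient φ) 2 (volume.restrict (perforatedCell ω)) := by
  obtain ⟨C, hC⟩ := exists_poincare hω (√d)
  refine ⟨NNReal.sqrt C, fun φ hφ hper hmean => ?_⟩
  obtain ⟨c, hc⟩ := hC φ hφ hper.gradient
  set μ := volume.restrict (perforatedCell ω)
  have hm : MemLp φ 2 μ := hφ.continuous.memLp_perforatedCell hω.isOpen 2
  have hsub : MemLp (fun x => φ x - c) 2 μ := hm.sub (memLp_const c)
  have hint : Integrable φ μ := hm.integrable (by norm_num)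
  -- For a mean-zero function, `0` is the best constant approximation in `L²`.
  have h1 : eLpNorm φ 2 μ ^ 2 ≤ eLpNorm (fun x => φ x - c) 2 μ ^ 2 := by
    have hreal : ∫ x, φ x ^ 2 ∂μ ≤ ∫ x, (φ x - c) ^ 2 ∂μ := by
      have : ∀ x, (φ x - c) ^ 2 = φ x ^ 2 - 2 * c * φ x + c ^ 2 := fun x => by ring
      simp only [this]
      have h2 : Integrable (fun x => 2 * c * φ x) μ := hint.const_mul _
      have h3 : Integrable (fun x => φ x ^ 2 - 2 * c * φ x) μ := hm.integrable_sq.sub h2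
      rw [integral_add h3 (integrable_const _), integral_sub hm.integrable_sq (hint.const_mul _), integral_const_mul, hmean,
        integral_const]
      have : 0 ≤ μ.real univ • c ^ 2 := by rw [smul_eq_mul]; positivity
      linarith
    have hconv : ∀ f : E d → ℝ, MemLp f 2 μ →
        eLpNorm f 2 μ ^ 2 = ENNReal.ofReal (∫ x, f x ^ 2 ∂μ) := by
      intro f hf
      rw [eLpNorm_two_sq, ofReal_integral_eq_lintegral_ofReal hf.integrable_sq
        (Filter.Eventually.of_forall fun x => sq_nonneg _)]
      refine lintegral_congr fun x => ?_
      rw [← ofReal_norm, ← ENNReal.ofReal_pow (norm_nonneg _), Real.norm_eq_abs, sq_abs]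
    rw [hconv _ hm, hconv _ hsub]
    exact ENNReal.ofReal_le_ofReal hreal
  have h2 : eLpNorm (fun x => φ x - c) 2 μ ^ 2 ≤ C * eLpNorm (gradient φ) 2 μ ^ 2 := by
    rw [eLpNorm_two_sq, eLpNorm_two_sq]
    exact (lintegral_mono_set (subset_inter inter_subset_right
      (perforatedCell_subset_closedBall ω))).trans hc
  have h3 : eLpNorm φ 2 μ ^ 2 ≤ ((NNReal.sqrt C : ℝ≥0) * eLpNorm (gradient φ) 2 μ) ^ 2 := by
    rw [mul_pow, ← ENNReal.coe_pow, NNReal.sq_sqrt]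
    exact h1.trans h2
  exact (ENNReal.pow_le_pow_left_iff two_ne_zero).1 h3

end PerforatedHomogenization

/-! ### Strongly monotone operators on Hilbert spaces. -/

namespace PerforatedHomogenization
open Set Metric Filter
open scoped NNReal Topology

/-- A strongly monotone Lipschitz operator on a Hilbert space has a zero. -/
theorem exists_eq_zero_of_stronglyMonotone {H : Type*} [NormedAddCommGroup H]
    [InnerProductSpace ℝ H] [CompleteSpace H] (T : H → H) {m L : ℝ} (hm : 0 < m) (hL : 0 < L)
    (hmono : ∀ x y, m * ‖x - y‖ ^ 2 ≤ inner ℝ (T x - T y) (x - y))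
    (hlip : ∀ x y, ‖T x - T y‖ ≤ L * ‖x - y‖) : ∃ x, T x = 0 := by
  -- This `ρ` minimises `1 - 2ρm + ρ²L²`, the bound on the squared contraction factor of `x ↦ x - ρ
  -- T x`; the minimum is `1 - m²/L²`. If it is negative, `K` is `0` and the estimate still holds.
  set ρ := m / L ^ 2
  have hρ : 0 < ρ := by positivity
  set K := √(1 - m ^ 2 / L ^ 2)
  have hK : K < 1 := by
    rw [Real.sqrt_lt' one_pos]
    have : 0 < m ^ 2 / L ^ 2 := by positivity
    linarith
  have hbound : ∀ x y, ‖(x - ρ • T x) - (y - ρ • T y)‖ ≤ K * ‖x - y‖ := by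
    intro x y
    have h1 : ‖(x - ρ • T x) - (y - ρ • T y)‖ ^ 2 ≤ (1 - m ^ 2 / L ^ 2) * ‖x - y‖ ^ 2 := by
      rw [show (x - ρ • T x) - (y - ρ • T y) = (x - y) - ρ • (T x - T y) by module,
        norm_sub_sq_real, inner_smul_right, norm_smul, Real.norm_of_nonneg hρ.le, mul_pow,
        real_inner_comm]
      have h2 := hmono x y
      have h3 : ‖T x - T y‖ ^ 2 ≤ (L * ‖x - y‖) ^ 2 :=
        pow_le_pow_left₀ (norm_nonneg _) (hlip x y) 2
      have h4 := mul_le_mul_of_nonneg_left h2 hρ.le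
      have h5 := mul_le_mul_of_nonneg_left h3 (sq_nonneg ρ)
      have h6 : ρ * m = m ^ 2 / L ^ 2 := by simp only [ρ]; ring
      have h7 : ρ ^ 2 * L ^ 2 = m ^ 2 / L ^ 2 := by simp only [ρ]; field_simp
      have h8 : ρ ^ 2 * (L * ‖x - y‖) ^ 2 = m ^ 2 / L ^ 2 * ‖x - y‖ ^ 2 := by
        rw [mul_pow, ← mul_assoc, h7]
      have h9 : ρ * (m * ‖x - y‖ ^ 2) = m ^ 2 / L ^ 2 * ‖x - y‖ ^ 2 := by rw [← mul_assoc, h6]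
      linarith
    have h2 := Real.sqrt_le_sqrt h1
    rwa [Real.sqrt_sq (norm_nonneg _), Real.sqrt_mul' _ (sq_nonneg _),
      Real.sqrt_sq (norm_nonneg _)] at h2
  have hc : ContractingWith (⟨K, Real.sqrt_nonneg _⟩ : ℝ≥0) fun x => x - ρ • T x :=
    ⟨by exact_mod_cast hK, LipschitzWith.of_dist_le_mul fun x y => by
      rw [dist_eq_norm, dist_eq_norm]; exact hbound x y⟩
  refine ⟨ContractingWith.fixedPoint _ hc, ?_⟩
  have h := sub_eq_self.1 hc.fixedPoint_isFixedPt
  exact (smul_eq_zero.1 h).resolve_left hρ.ne'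

/-- A strongly monotone Lipschitz operator satisfies the variational equation on every complete
subspace. -/
theorem exists_mem_inner_eq_zero_of_stronglyMonotone {H : Type*} [NormedAddCommGroup H]
    [InnerProductSpace ℝ H] (V : Submodule ℝ H) [CompleteSpace V] (T : H → H) {m L : ℝ}
    (hm : 0 < m) (hL : 0 < L)
    (hmono : ∀ x y, m * ‖x - y‖ ^ 2 ≤ inner ℝ (T x - T y) (x - y))
    (hlip : ∀ x y, ‖T x - T y‖ ≤ L * ‖x - y‖) :
    ∃ g ∈ V, ∀ h ∈ V, inner ℝ (T g) h = 0 := by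
  -- Compressing `T` to `V` by the orthogonal projection preserves both constants.
  have hmono' : ∀ x y : V, m * ‖x - y‖ ^ 2 ≤ inner ℝ
      (V.orthogonalProjectionOnto (T x) - V.orthogonalProjectionOnto (T y)) (x - y) := by
    intro x y
    rw [← map_sub, real_inner_comm, Submodule.inner_orthogonalProjectionOnto_eq_of_mem_left,
      real_inner_comm]
    exact hmono x y
  have hlip' : ∀ x y : V,
      ‖V.orthogonalProjectionOnto (T x) - V.orthogonalProjectionOnto (T y)‖ ≤ L * ‖x - y‖ := by
    intro x y
    rw [← map_sub]
    exact (V.norm_orthogonalProjectionOnto_apply_le _).trans (hlip x y)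
  obtain ⟨g, hg⟩ := exists_eq_zero_of_stronglyMonotone
    (fun x : V => V.orthogonalProjectionOnto (T x)) hm hL hmono' hlip'
  refine ⟨g, g.2, fun h hh => ?_⟩
  rw [real_inner_comm, ← Submodule.inner_orthogonalProjectionOnto_eq_of_mem_left ⟨h, hh⟩, hg,
    inner_zero_right]

/-! ### The space of periodic gradients and recovery of the potential. -/

variable {d : ℕ} {ω : Set (E d)}

/-- Lebesgue measure on the perforated cell. -/
noncomputable abbrev cellMeasure (ω : Set (E d)) : Measure (E d) :=
  volume.restrict (perforatedCell ω)

lemma gradient_add {φ ψ : E d → ℝ} (hφ : Differentiable ℝ φ) (hψ : Differentiable ℝ ψ) (x : E d) :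
    gradient (fun y => φ y + ψ y) x = gradient φ x + gradient ψ x := by
  simp only [gradient, fderiv_fun_add (hφ x) (hψ x), map_add]

lemma gradient_sub {φ ψ : E d → ℝ} (hφ : Differentiable ℝ φ) (hψ : Differentiable ℝ ψ) (x : E d) :
    gradient (fun y => φ y - ψ y) x = gradient φ x - gradient ψ x := by
  simp only [gradient, fderiv_fun_sub (hφ x) (hψ x), map_sub]

lemma gradient_const_mul {φ : E d → ℝ} (hφ : Differentiable ℝ φ) (c : ℝ) (x : E d) :
    gradient (fun y => c * φ y) x = c • gradient φ x := by
  simp only [gradient, fderiv_const_mul (hφ x) c, map_smul]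

/-- Gradients of smooth 1-periodic functions, as a subspace of `L²(Y ∩ ω)`. -/
noncomputable def smoothGradients (ω : Set (E d)) : Submodule ℝ (Lp (E d) 2 (cellMeasure ω)) where
  carrier := {g | ∃ φ : E d → ℝ, ContDiff ℝ (⊤ : ℕ∞) φ ∧ IsOnePeriodic φ ∧
    g =ᵐ[cellMeasure ω] gradient φ}
  add_mem' := by
    rintro f g ⟨φ, hφ, hφp, hf⟩ ⟨ψ, hψ, hψp, hg⟩
    refine ⟨fun y => φ y + ψ y, hφ.add hψ, fun k y => by simp only [hφp k y, hψp k y], ?_⟩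
    filter_upwards [Lp.coeFn_add f g, hf, hg] with x h1 h2 h3
    rw [h1, Pi.add_apply, h2, h3,
      gradient_add (hφ.differentiable (by simp)) (hψ.differentiable (by simp))]
  zero_mem' := by
    refine ⟨fun _ => 0, contDiff_const, fun _ _ => rfl, ?_⟩
    filter_upwards [Lp.coeFn_zero (E d) 2 (cellMeasure ω)] with x h1
    rw [h1]
    simp
  smul_mem' := by
    rintro c f ⟨φ, hφ, hφp, hf⟩
    refine ⟨fun y => c * φ y, contDiff_const.mul hφ, fun k y => by simp only [hφp k y], ?_⟩
    filter_upwards [Lp.coeFn_smul c f, hf] with x h1 h2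
    rw [h1, Pi.smul_apply, h2, gradient_const_mul (hφ.differentiable (by simp))]

/-- The closure in `L²(Y ∩ ω)` of the gradients of smooth 1-periodic functions. -/
noncomputable def gradientSpace (ω : Set (E d)) : Submodule ℝ (Lp (E d) 2 (cellMeasure ω)) :=
  (smoothGradients ω).topologicalClosure

instance (ω : Set (E d)) : CompleteSpace (gradientSpace ω) :=
  (smoothGradients ω).isClosed_topologicalClosure.completeSpace_coe

lemma _root_.ContDiff.memLp_gradient {φ : E d → ℝ} (hφ : ContDiff ℝ (⊤ : ℕ∞) φ) (hω : IsOpen ω) :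
    MemLp (gradient φ) 2 (cellMeasure ω) :=
  (continuous_gradient (hφ.of_le (by exact_mod_cast le_top))).memLp_perforatedCell hω 2

lemma MemH1Per.toLp_mem_gradientSpace (hω : IsOpen ω) {u : E d → ℝ} {G : E d → E d}
    (h : MemH1Per ω u G) : h.memLp_grad.toLp G ∈ gradientSpace ω := by
  rw [← SetLike.mem_coe, gradientSpace, Submodule.topologicalClosure_coe, EMetric.mem_closure_iff]
  intro ε hε
  obtain ⟨φ, hφ, hφp, -, hG⟩ := h.approx ε hε
  refine ⟨(hφ.memLp_gradient hω).toLp _, ⟨φ, hφ, hφp, MemLp.coeFn_toLp _⟩, ?_⟩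
  rw [Lp.edist_toLp_toLp]
  exact hG

/-- For smooth gradients this is `exists_enorm_sq_le_setLIntegral`; the inequality is a closed
condition on `g`, so it passes to the `L²` closure. -/
theorem exists_mul_norm_sq_le (hω : IsReferenceDomain ω) :
    ∃ c > 0, ∀ g ∈ gradientSpace ω, ∀ η : E d,
      c * ‖η‖ ^ 2 ≤ ‖Lp.const 2 (cellMeasure ω) η + g‖ ^ 2 := by
  obtain ⟨C, hC⟩ := exists_enorm_sq_le_setLIntegral hω
  have hbound : ∀ g ∈ gradientSpace ω, ∀ η : E d,
      ‖η‖ ^ 2 ≤ C * ‖Lp.const 2 (cellMeasure ω) η + g‖ ^ 2 := by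
    intro g hg η
    have hcl : IsClosed {g : Lp (E d) 2 (cellMeasure ω) |
        ‖η‖ ^ 2 ≤ C * ‖Lp.const 2 (cellMeasure ω) η + g‖ ^ 2} :=
      isClosed_le continuous_const (by fun_prop)
    refine closure_minimal ?_ hcl hg
    rintro g ⟨φ, hφ, hφp, hg⟩
    have h1 := hC φ (hφ.of_le (by exact_mod_cast le_top)) hφp η
    rw [← eLpNorm_two_sq] at h1
    have h2 : eLpNorm (fun x => η + gradient φ x) 2 (cellMeasure ω) =
        ‖Lp.const 2 (cellMeasure ω) η + g‖ₑ := by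
      rw [Lp.enorm_def]
      refine eLpNorm_congr_ae ?_
      filter_upwards [Lp.coeFn_add (Lp.const 2 (cellMeasure ω) η) g, hg,
        Lp.coeFn_const 2 (cellMeasure ω) η] with x h1 h2 h3
      rw [h1, Pi.add_apply, h2, h3, Function.const_apply]
    rw [h2] at h1
    have h3 := ENNReal.toReal_mono (ENNReal.mul_ne_top (by simp) (by simp)) h1
    simpa [ENNReal.toReal_mul, ENNReal.toReal_pow] using h3
  -- `C + 1` rather than `C`, which might be zero.
  refine ⟨(C + 1 : ℝ)⁻¹, by positivity, fun g hg η => ?_⟩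
  rw [inv_mul_le_iff₀ (by positivity)]
  have := hbound g hg η
  nlinarith [sq_nonneg ‖Lp.const 2 (cellMeasure ω) η + g‖]

section TestFunction

variable {ψ : E d → ℝ}

lemma fderiv_eq_zero_of_notMem_tsupport {x : E d} (hx : x ∉ tsupport ψ) :
    fderiv ℝ ψ x = 0 :=
  image_eq_zero_of_notMem_tsupport fun h => hx (tsupport_fderiv_subset ℝ h)

/-- Integration by parts against a test function supported in the perforated cell. -/
lemma integral_fderiv_mul_add_eq_zero (hψ : ContDiff ℝ (⊤ : ℕ∞) ψ)
    (hc : HasCompactSupport ψ) (hs : tsupport ψ ⊆ interior (perforatedCell ω))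
    {φ : E d → ℝ} (hφ : ContDiff ℝ (⊤ : ℕ∞) φ) (v : E d) :
    ∫ x, fderiv ℝ ψ x v * φ x ∂cellMeasure ω + ∫ x, ψ x * fderiv ℝ φ x v ∂cellMeasure ω = 0 := by
  have hout : ∀ x, x ∉ perforatedCell ω → x ∉ tsupport ψ := fun x hx h =>
    hx (interior_subset (hs h))
  have hψc : Continuous fun x => fderiv ℝ ψ x v :=
    (hψ.continuous_fderiv (by simp)).clm_apply continuous_const
  have hφc : Continuous fun x => fderiv ℝ φ x v :=
    (hφ.continuous_fderiv (by simp)).clm_apply continuous_const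
  have hc' : HasCompactSupport fun x => fderiv ℝ ψ x v := hc.fderiv_apply ℝ v
  rw [setIntegral_eq_integral_of_forall_compl_eq_zero,
    setIntegral_eq_integral_of_forall_compl_eq_zero,
    integral_mul_fderiv_eq_neg_fderiv_mul_of_integrable, add_neg_cancel]
  · exact (hψc.mul hφ.continuous).integrable_of_hasCompactSupport hc'.mul_right
  · exact (hψ.continuous.mul hφc).integrable_of_hasCompactSupport hc.mul_right
  · exact (hψ.continuous.mul hφ.continuous).integrable_of_hasCompactSupport hc.mul_right
  · exact fun x _ => hψ.differentiable (by simp) x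
  · exact fun x _ => hφ.differentiable (by simp) x
  · intro x hx
    rw [image_eq_zero_of_notMem_tsupport (hout x hx), zero_mul]
  · intro x hx
    rw [fderiv_eq_zero_of_notMem_tsupport (hout x hx)]
    simp

/-- Turns the vector identity on the interior into scalar identities over the whole cell, where `L²`
limits are taken; `ψ` and its gradient vanish on the difference. -/
lemma setIntegral_interior_eq_neg (hω : IsOpen ω) (hψ : ContDiff ℝ (⊤ : ℕ∞) ψ)
    (hs : tsupport ψ ⊆ interior (perforatedCell ω)) {u : E d → ℝ} {G : E d → E d}
    (hu : MemLp u 2 (cellMeasure ω)) (hG : MemLp G 2 (cellMeasure ω))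
    (h : ∀ v : E d, ∫ x, fderiv ℝ ψ x v * u x ∂cellMeasure ω +
      ∫ x, ψ x * inner ℝ v (G x) ∂cellMeasure ω = 0) :
    ∫ x in interior (perforatedCell ω), u x • gradient ψ x =
      -∫ x in interior (perforatedCell ω), ψ x • G x := by
  have hm := measurableSet_perforatedCell hω
  have hout : ∀ x ∈ perforatedCell ω \ interior (perforatedCell ω), x ∉ tsupport ψ :=
    fun x hx h => hx.2 (hs h)
  rw [← setIntegral_eq_of_subset_of_forall_sdiff_eq_zero (f := fun x => u x • gradient ψ x) hm
      interior_subset fun x hx => by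
        simp [gradient, fderiv_eq_zero_of_notMem_tsupport (hout x hx)],
    ← setIntegral_eq_of_subset_of_forall_sdiff_eq_zero (f := fun x => ψ x • G x) hm
      interior_subset fun x hx => by simp [image_eq_zero_of_notMem_tsupport (hout x hx)]]
  have h1 : Integrable (fun x => u x • gradient ψ x) (cellMeasure ω) :=
    memLp_one_iff_integrable.1 ((hψ.memLp_gradient hω).smul hu)
  have h2 : Integrable (fun x => ψ x • G x) (cellMeasure ω) :=
    memLp_one_iff_integrable.1 (hG.smul (hψ.continuous.memLp_perforatedCell hω 2))
  rw [eq_neg_iff_add_eq_zero]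
  refine ext_inner_left ℝ fun v => ?_
  rw [inner_add_right, ← integral_inner h1, ← integral_inner h2, inner_zero_right, ← h v]
  congr 1
  · refine integral_congr_ae (Eventually.of_forall fun x => ?_)
    simp only [inner_smul_right]
    rw [real_inner_comm, inner_gradient_left, mul_comm]
  · refine integral_congr_ae (Eventually.of_forall fun x => ?_)
    simp only [inner_smul_right]

end TestFunction

/-- Approximating potentials, normalised to mean zero, are Cauchy in `L²` by Poincaré–Wirtinger
because their gradients converge. Their limit is `N`. -/
theorem exists_memH1Per_of_mem_gradientSpace (hω : IsReferenceDomain ω)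
    {g : Lp (E d) 2 (cellMeasure ω)} (hg : g ∈ gradientSpace ω) :
    ∃ N : E d → ℝ, MemH1Per ω N g ∧ ⨍ y in perforatedCell ω, N y = 0 := by
  obtain ⟨K, hK⟩ := exists_eLpNorm_le_eLpNorm_gradient hω
  obtain ⟨x, hx, hxg⟩ := mem_closure_iff_seq_limit.1 hg
  choose φ₀ hφ₀ hφ₀p hxφ using hx
  set φ : ℕ → E d → ℝ := fun n y => φ₀ n y - ⨍ z, φ₀ n z ∂cellMeasure ω
  have hφ : ∀ n, ContDiff ℝ (⊤ : ℕ∞) (φ n) := fun n => (hφ₀ n).sub contDiff_const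
  have hdiff : ∀ n, Differentiable ℝ (φ n) := fun n => (hφ n).differentiable (by simp)
  have hφp : ∀ n, IsOnePeriodic (φ n) := fun n k y => by simp only [φ, hφ₀p n k y]
  have hgrad : ∀ n, gradient (φ n) = gradient (φ₀ n) := fun n => funext fun y => by
    simp only [φ, gradient, fderiv_sub_const]
  have hLp : ∀ n, MemLp (φ n) 2 (cellMeasure ω) := fun n =>
    (hφ n).continuous.memLp_perforatedCell hω.isOpen 2
  have hLpg : ∀ n, MemLp (gradient (φ n)) 2 (cellMeasure ω) := fun n => (hφ n).memLp_gradient hω.isOpen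
  have hmean : ∀ n, ∫ y, φ n y ∂cellMeasure ω = 0 := fun n => integral_sub_average _ _
  set f : ℕ → Lp ℝ 2 (cellMeasure ω) := fun n => (hLp n).toLp _
  set G : ℕ → Lp (E d) 2 (cellMeasure ω) := fun n => (hLpg n).toLp _
  have hGg : Tendsto G atTop (𝓝 g) := by
    convert hxg using 1
    ext1 n
    refine Lp.ext ?_
    filter_upwards [hxφ n, MemLp.coeFn_toLp (hLpg n)] with y h1 h2
    rw [h1, h2, hgrad]
  have hdist : ∀ n m, dist (f n) (f m) ≤ K * dist (G n) (G m) := by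
    intro n m
    have h1 := hK (fun y => φ n y - φ m y) (((hφ n).sub (hφ m)).of_le (by exact_mod_cast le_top))
      (fun k y => by simp only [hφp n k y, hφp m k y]) (by
        rw [integral_sub ((hLp n).integrable (by norm_num)) ((hLp m).integrable (by norm_num)),
          hmean, hmean, sub_zero])
    rw [funext fun y => gradient_sub (hdiff n) (hdiff m) y] at h1
    have h2 : edist (f n) (f m) ≤ K * edist (G n) (G m) := by
      rw [Lp.edist_toLp_toLp, Lp.edist_toLp_toLp]
      exact h1
    rw [edist_dist, edist_dist, ← ENNReal.ofReal_coe_nnreal,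
      ← ENNReal.ofReal_mul (by positivity)] at h2
    exact (ENNReal.ofReal_le_ofReal_iff (by positivity)).1 h2
  have hcau : CauchySeq f := by
    rw [Metric.cauchySeq_iff']
    intro ε hε
    obtain ⟨n, hn⟩ := Metric.cauchySeq_iff'.1 hGg.cauchySeq (ε / (K + 1)) (by positivity)
    refine ⟨n, fun m hm => (hdist m n).trans_lt ?_⟩
    have h1 := hn m hm
    rw [lt_div_iff₀ (by positivity)] at h1
    nlinarith [dist_nonneg (x := G m) (y := G n)]
  obtain ⟨N, hN⟩ := cauchySeq_tendsto_of_complete hcau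
  refine ⟨N, ⟨⟨Lp.memLp N, Lp.memLp g, ?_⟩, ?_⟩, ?_⟩
  · intro ψ hψ hc hs
    refine setIntegral_interior_eq_neg hω.isOpen hψ hs (Lp.memLp N) (Lp.memLp g) fun v => ?_
    have ha : MemLp (fun x => fderiv ℝ ψ x v) 2 (cellMeasure ω) :=
      ((hψ.continuous_fderiv (by simp)).clm_apply continuous_const).memLp_perforatedCell hω.isOpen 2
    have hb : MemLp (fun x => ψ x • v) 2 (cellMeasure ω) :=
      (hψ.continuous.smul continuous_const).memLp_perforatedCell hω.isOpen 2
    -- As inner products with fixed elements, both integrals are continuous under `L²` convergence.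
    have key : ∀ (u : Lp ℝ 2 (cellMeasure ω)) (H : Lp (E d) 2 (cellMeasure ω)),
        inner ℝ (ha.toLp _) u + inner ℝ (hb.toLp _) H =
          ∫ x, fderiv ℝ ψ x v * u x ∂cellMeasure ω + ∫ x, ψ x * inner ℝ v (H x) ∂cellMeasure ω := by
      intro u H
      rw [L2.inner_def, L2.inner_def]
      congr 1
      · refine integral_congr_ae ?_
        filter_upwards [ha.coeFn_toLp] with x hx
        rw [hx]
        simp [mul_comm]
      · refine integral_congr_ae ?_
        filter_upwards [hb.coeFn_toLp] with x hx
        rw [hx, real_inner_smul_left]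
    rw [← key]
    have hlim : Tendsto (fun n => inner ℝ (ha.toLp _) (f n) + inner ℝ (hb.toLp _) (G n)) atTop
        (𝓝 (inner ℝ (ha.toLp _) N + inner ℝ (hb.toLp _) g)) :=
      (tendsto_const_nhds.inner hN).add (tendsto_const_nhds.inner hGg)
    refine tendsto_nhds_unique hlim (tendsto_const_nhds.congr fun n => ?_)
    rw [key, ← integral_fderiv_mul_add_eq_zero hψ hc hs (hφ n) v]
    congr 1
    · refine integral_congr_ae ?_
      filter_upwards [(hLp n).coeFn_toLp] with x hx
      rw [hx]
    · refine integral_congr_ae ?_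
      filter_upwards [(hLpg n).coeFn_toLp] with x hx
      rw [hx, real_inner_comm, inner_gradient_left]
  · intro ε hε
    have h1 := (tendsto_iff_edist_tendsto_0.1 hN).eventually_lt_const hε
    have h2 := (tendsto_iff_edist_tendsto_0.1 hGg).eventually_lt_const hε
    obtain ⟨n, h1, h2⟩ := (h1.and h2).exists
    refine ⟨φ n, hφ n, hφp n, lt_of_eq_of_lt ?_ h1, lt_of_eq_of_lt ?_ h2⟩
    · rw [edist_comm, Lp.edist_def]
      refine eLpNorm_congr_ae ?_
      filter_upwards [(hLp n).coeFn_toLp] with x hx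
      rw [Pi.sub_apply, hx]
    · rw [edist_comm, Lp.edist_def]
      refine eLpNorm_congr_ae ?_
      filter_upwards [(hLpg n).coeFn_toLp] with x hx
      rw [Pi.sub_apply, hx]
  · have key : ∀ u : Lp ℝ 2 (cellMeasure ω), inner ℝ (Lp.const 2 (cellMeasure ω) (1 : ℝ)) u = ∫ x, u x ∂cellMeasure ω := by
      intro u
      rw [L2.inner_def]
      refine integral_congr_ae ?_
      filter_upwards [Lp.coeFn_const 2 (cellMeasure ω) (1 : ℝ)] with x hx
      rw [hx]
      simp
    have hint : ∫ x, N x ∂cellMeasure ω = 0 := by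
      rw [← key]
      have hlim : Tendsto (fun n => inner ℝ (Lp.const 2 (cellMeasure ω) (1 : ℝ)) (f n)) atTop
          (𝓝 (inner ℝ (Lp.const 2 (cellMeasure ω) (1 : ℝ)) N)) := tendsto_const_nhds.inner hN
      refine tendsto_nhds_unique hlim (tendsto_const_nhds.congr fun n => ?_)
      rw [key, ← hmean n]
      exact (integral_congr_ae (hLp n).coeFn_toLp).symm
    rw [average_eq, hint, smul_zero]

end PerforatedHomogenization

/-! ### The superposition operator, correctors and the effective field. -/

namespace PerforatedHomogenization
open Set Metric Filter
open scoped NNReal Topology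

variable {d : ℕ} {ω : Set (E d)} {μ₀ μ₁ : ℝ} {A : E d → E d → E d}

namespace IsAdmissibleField

lemma norm_le (hA : IsAdmissibleField μ₀ μ₁ A) (y ξ : E d) : ‖A y ξ‖ ≤ μ₁ * ‖ξ‖ := by
  simpa [hA.map_zero y] using hA.growth y ξ 0

lemma memLp (hA : IsAdmissibleField μ₀ μ₁ A) {f : E d → E d} {μ : Measure (E d)}
    (hf : MemLp f 2 μ) : MemLp (fun y => A y (f y)) 2 μ :=
  hf.of_le_mul (hA.contDiff.continuous.comp_aestronglyMeasurable
    (aestronglyMeasurable_id.prodMk hf.1)) (Eventually.of_forall fun y => hA.norm_le y (f y))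

/-- The superposition operator `f ↦ A(·, f(·))` on `L²(Y ∩ ω)`. -/
noncomputable def superposition (hA : IsAdmissibleField μ₀ μ₁ A) (ω : Set (E d))
    (f : Lp (E d) 2 (cellMeasure ω)) : Lp (E d) 2 (cellMeasure ω) :=
  (hA.memLp (Lp.memLp f)).toLp _

lemma coeFn_superposition (hA : IsAdmissibleField μ₀ μ₁ A)
    (f : Lp (E d) 2 (cellMeasure ω)) :
    hA.superposition ω f =ᵐ[cellMeasure ω] fun y => A y (f y) :=
  MemLp.coeFn_toLp _

lemma superposition_zero (hA : IsAdmissibleField μ₀ μ₁ A) : hA.superposition ω 0 = 0 := by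
  refine Lp.ext ?_
  filter_upwards [hA.coeFn_superposition (ω := ω) 0, Lp.coeFn_zero (E d) 2 (cellMeasure ω)]
    with y h1 h2
  rw [h1, h2, Pi.zero_apply, hA.map_zero]

lemma superposition_lipschitz (hA : IsAdmissibleField μ₀ μ₁ A)
    (f g : Lp (E d) 2 (cellMeasure ω)) :
    ‖hA.superposition ω f - hA.superposition ω g‖ ≤ μ₁ * ‖f - g‖ := by
  refine Lp.norm_le_mul_norm_of_ae_le_mul ?_
  filter_upwards [hA.coeFn_superposition f, hA.coeFn_superposition g,
    Lp.coeFn_sub (hA.superposition ω f) (hA.superposition ω g), Lp.coeFn_sub f g]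
    with y h1 h2 h3 h4
  rw [h3, h4, Pi.sub_apply, Pi.sub_apply, h1, h2]
  exact hA.growth _ _ _

lemma superposition_monotone (hA : IsAdmissibleField μ₀ μ₁ A)
    (f g : Lp (E d) 2 (cellMeasure ω)) :
    μ₀ * ‖f - g‖ ^ 2 ≤ inner ℝ (hA.superposition ω f - hA.superposition ω g) (f - g) := by
  rw [← real_inner_self_eq_norm_sq, L2.inner_def, L2.inner_def, ← integral_const_mul]
  refine integral_mono_ae ((L2.integrable_inner _ _).const_mul _) (L2.integrable_inner _ _) ?_
  filter_upwards [hA.coeFn_superposition f, hA.coeFn_superposition g,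
    Lp.coeFn_sub (hA.superposition ω f) (hA.superposition ω g), Lp.coeFn_sub f g]
    with y h1 h2 h3 h4
  rw [h3, h4, Pi.sub_apply, Pi.sub_apply, h1, h2, real_inner_self_eq_norm_sq]
  exact hA.monotone _ _ _

lemma superposition_const_add (hA : IsAdmissibleField μ₀ μ₁ A) (ξ : E d)
    (g : Lp (E d) 2 (cellMeasure ω)) :
    hA.superposition ω (Lp.const 2 (cellMeasure ω) ξ + g) =ᵐ[cellMeasure ω]
      fun y => A y (ξ + g y) := by
  filter_upwards [hA.coeFn_superposition (Lp.const 2 (cellMeasure ω) ξ + g),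
    Lp.coeFn_add (Lp.const 2 (cellMeasure ω) ξ) g,
    Lp.coeFn_const 2 (cellMeasure ω) ξ] with y h1 h2 h3
  rw [h1, h2, Pi.add_apply, h3, Function.const_apply]

/-- The cell problem is the variational equation on `gradientSpace ω` for `g ↦ A(·, ξ + g)`; the
constant shift leaves monotonicity and Lipschitz constants unchanged. -/
theorem exists_isCorrector (hA : IsAdmissibleField μ₀ μ₁ A) (hω : IsReferenceDomain ω)
    (hμ₀ : 0 < μ₀) (hμ₁ : 0 < μ₁) (ξ : E d) :
    ∃ (N : E d → ℝ) (G : E d → E d), IsCorrector A ω ξ N G := by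
  set κ := Lp.const 2 (cellMeasure ω) ξ
  have hmono : ∀ x y, μ₀ * ‖x - y‖ ^ 2 ≤
      inner ℝ (hA.superposition ω (κ + x) - hA.superposition ω (κ + y)) (x - y) := by
    intro x y
    have := hA.superposition_monotone (κ + x) (κ + y)
    rwa [add_sub_add_left_eq_sub] at this
  have hlip : ∀ x y, ‖hA.superposition ω (κ + x) - hA.superposition ω (κ + y)‖ ≤
      μ₁ * ‖x - y‖ := by
    intro x y
    have := hA.superposition_lipschitz (κ + x) (κ + y)
    rwa [add_sub_add_left_eq_sub] at this
  obtain ⟨g, hg, horth⟩ := exists_mem_inner_eq_zero_of_stronglyMonotone (gradientSpace ω)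
    (fun g => hA.superposition ω (κ + g)) hμ₀ hμ₁ hmono hlip
  obtain ⟨N, hN, hmean⟩ := exists_memH1Per_of_mem_gradientSpace hω hg
  refine ⟨N, g, hN, hmean, fun v H hv => ?_⟩
  rw [← horth _ (hv.toLp_mem_gradientSpace hω.isOpen), L2.inner_def]
  refine integral_congr_ae ?_
  filter_upwards [hA.superposition_const_add ξ g, hv.memLp_grad.coeFn_toLp] with y h1 h2
  rw [h1, h2]

end IsAdmissibleField

/-- The class in `L²(Y ∩ ω)` of the gradient of a corrector. -/
noncomputable def IsCorrector.gradLp {ξ : E d} {N : E d → ℝ} {G : E d → E d}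
    (h : IsCorrector A ω ξ N G) : Lp (E d) 2 (cellMeasure ω) :=
  h.memH1Per.memLp_grad.toLp G

section Corrector

variable {ξ : E d} {N : E d → ℝ} {G : E d → E d}

lemma IsCorrector.superposition_ae (h : IsCorrector A ω ξ N G) (hA : IsAdmissibleField μ₀ μ₁ A) :
    hA.superposition ω (Lp.const 2 (cellMeasure ω) ξ + h.gradLp) =ᵐ[cellMeasure ω]
      fun y => A y (ξ + G y) := by
  filter_upwards [hA.superposition_const_add ξ h.gradLp, h.memH1Per.memLp_grad.coeFn_toLp]
    with y h1 h2
  rw [h1]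
  simp only [IsCorrector.gradLp, h2]

lemma IsCorrector.inner_superposition_eq_zero (h : IsCorrector A ω ξ N G)
    (hA : IsAdmissibleField μ₀ μ₁ A) {v : E d → ℝ} {H : E d → E d} (hv : MemH1Per ω v H) :
    inner ℝ (hA.superposition ω (Lp.const 2 (cellMeasure ω) ξ + h.gradLp))
      (hv.memLp_grad.toLp H) = 0 := by
  rw [← h.weak_eq v H hv, L2.inner_def]
  refine integral_congr_ae ?_
  filter_upwards [h.superposition_ae hA, hv.memLp_grad.coeFn_toLp] with y h1 h2
  rw [h1, h2]

end Corrector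

/-- Moves all estimates on `Â` into `L²(Y ∩ ω)`, where `ζ` becomes a constant field. -/
lemma inner_effectiveField (hA : IsAdmissibleField μ₀ μ₁ A)
    {N : E d → E d → ℝ} {gradN : E d → E d → E d}
    (h : ∀ ξ, IsCorrector A ω ξ (N ξ) (gradN ξ)) (ξ ζ : E d) :
    inner ℝ (effectiveField A ω gradN ξ) ζ = (volume.real (perforatedCell ω))⁻¹ *
      inner ℝ (hA.superposition ω (Lp.const 2 (cellMeasure ω) ξ + (h ξ).gradLp))
        (Lp.const 2 (cellMeasure ω) ζ) := by
  have hint : Integrable (hA.superposition ω (Lp.const 2 (cellMeasure ω) ξ + (h ξ).gradLp))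
      (cellMeasure ω) := (Lp.memLp _).integrable (by norm_num)
  rw [effectiveField, real_inner_smul_left, ← integral_congr_ae ((h ξ).superposition_ae hA),
    real_inner_comm, ← integral_inner hint, L2.inner_def]
  congr 1
  refine integral_congr_ae ?_
  filter_upwards [Lp.coeFn_const 2 (cellMeasure ω) ζ] with y hy
  rw [hy, Function.const_apply, real_inner_comm]

lemma norm_const_sq (ω : Set (E d)) (η : E d) :
    ‖Lp.const 2 (cellMeasure ω) η‖ ^ 2 = volume.real (perforatedCell ω) * ‖η‖ ^ 2 := by
  rw [Lp.norm_const' 2 _ _ (by norm_num) (by norm_num), mul_pow, ← Real.rpow_natCast (_ ^ _),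
    ← Real.rpow_mul measureReal_nonneg]
  norm_num
  rw [mul_comm]

end PerforatedHomogenization

/-! ### Coercivity, Lipschitz bound and value at zero. -/

theorem lemma2p2 (d : ℕ) (hd : 2 ≤ d) (ω : Set (E d)) (hω : IsReferenceDomain ω)
    (μ₀ μ₁ : ℝ) (hμ₀ : 0 < μ₀) (hμ₁ : 0 < μ₁) :
    ∃ C₁ > 0, ∃ C > 0, ∀ A : E d → E d → E d, IsAdmissibleField μ₀ μ₁ A →
      (∀ ξ : E d, ∃ (N : E d → ℝ) (G : E d → E d), IsCorrector A ω ξ N G) ∧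
      ∀ (N : E d → E d → ℝ) (gradN : E d → E d → E d),
        (∀ ξ : E d, IsCorrector A ω ξ (N ξ) (gradN ξ)) →
        (∀ ξ ξ' : E d, C₁ * ‖ξ - ξ'‖ ^ 2 ≤
          inner ℝ (effectiveField A ω gradN ξ - effectiveField A ω gradN ξ') (ξ - ξ')) ∧
        (∀ ξ ξ' : E d,
          ‖effectiveField A ω gradN ξ - effectiveField A ω gradN ξ'‖ ≤ C * ‖ξ - ξ'‖) ∧
        effectiveField A ω gradN 0 = 0 := by
  obtain ⟨c, hc, hcoer⟩ := exists_mul_norm_sq_le hω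
  set θ := volume.real (perforatedCell ω) with hθdef
  have hθ : 0 < θ := ENNReal.toReal_pos (volume_perforatedCell_ne_zero hω)
    (volume_perforatedCell_ne_top ω)
  refine ⟨θ⁻¹ * (μ₀ * c), by positivity, μ₁ ^ 2 / μ₀, by positivity, fun A hA =>
    ⟨hA.exists_isCorrector hω hμ₀ hμ₁, fun N gradN h => ?_⟩⟩
  let κ : E d → Lp (E d) 2 (cellMeasure ω) := fun η => Lp.const 2 (cellMeasure ω) η
  let p : E d → Lp (E d) 2 (cellMeasure ω) := fun ξ => κ ξ + (h ξ).gradLp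
  let B : E d → Lp (E d) 2 (cellMeasure ω) := fun ξ => hA.superposition ω (p ξ)
  have hκ : ∀ η, ‖κ η‖ ^ 2 = θ * ‖η‖ ^ 2 := norm_const_sq ω
  have hfield : ∀ ξ ζ, inner ℝ (effectiveField A ω gradN ξ) ζ = θ⁻¹ * inner ℝ (B ξ) (κ ζ) :=
    inner_effectiveField hA h
  have horth : ∀ ξ ξ', inner ℝ (B ξ) (h ξ').gradLp = 0 := fun ξ ξ' =>
    (h ξ).inner_superposition_eq_zero hA (h ξ').memH1Per
  have hmem : ∀ ξ, (h ξ).gradLp ∈ gradientSpace ω := fun ξ =>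
    (h ξ).memH1Per.toLp_mem_gradientSpace hω.isOpen
  have hsub : ∀ ξ ξ', p ξ - p ξ' = κ (ξ - ξ') + ((h ξ).gradLp - (h ξ').gradLp) := by
    intro ξ ξ'
    simp only [p, κ, map_sub]
    abel
  -- Both fluxes are orthogonal to both corrector gradients, so only the constant part of `p ξ - p
  -- ξ'` survives.
  have henergy : ∀ ξ ξ', μ₀ * ‖p ξ - p ξ'‖ ^ 2 ≤ inner ℝ (B ξ - B ξ') (κ (ξ - ξ')) := by
    intro ξ ξ'
    refine (hA.superposition_monotone (p ξ) (p ξ')).trans (le_of_eq ?_)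
    rw [hsub, inner_add_right, inner_sub_right, inner_sub_left, inner_sub_left, inner_sub_left]
    have h1 := horth ξ ξ
    have h2 := horth ξ ξ'
    have h3 := horth ξ' ξ
    have h4 := horth ξ' ξ'
    simp only [B] at h1 h2 h3 h4 ⊢
    rw [h1, h2, h3, h4]
    simp
  have hlip : ∀ ξ ξ', ‖B ξ - B ξ'‖ ≤ μ₁ * ‖p ξ - p ξ'‖ := fun ξ ξ' =>
    hA.superposition_lipschitz _ _
  have hdiff : ∀ ξ ξ' ζ, inner ℝ (effectiveField A ω gradN ξ - effectiveField A ω gradN ξ') ζ =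
      θ⁻¹ * inner ℝ (B ξ - B ξ') (κ ζ) := by
    intro ξ ξ' ζ
    rw [inner_sub_left, hfield, hfield, inner_sub_left, mul_sub]
  -- Cauchy–Schwarz in `henergy`, then division by `‖p ξ - p ξ'‖`.
  have hp : ∀ ξ ξ', ‖p ξ - p ξ'‖ ≤ μ₁ / μ₀ * ‖κ (ξ - ξ')‖ := by
    intro ξ ξ'
    rcases (norm_nonneg (p ξ - p ξ')).eq_or_lt with h0 | h0
    · rw [← h0]; positivity
    · have h1 := (henergy ξ ξ').trans ((real_inner_le_norm _ _).trans
        (mul_le_mul_of_nonneg_right (hlip ξ ξ') (norm_nonneg _)))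
      rw [div_mul_eq_mul_div, le_div_iff₀ hμ₀]
      refine le_of_mul_le_mul_right ?_ h0
      linarith
  refine ⟨fun ξ ξ' => ?_, fun ξ ξ' => ?_, ?_⟩
  · rw [hdiff, mul_assoc]
    refine mul_le_mul_of_nonneg_left (le_trans ?_ (henergy ξ ξ')) (inv_nonneg.2 hθ.le)
    rw [mul_assoc, hsub]
    exact mul_le_mul_of_nonneg_left
      (hcoer _ (Submodule.sub_mem _ (hmem ξ) (hmem ξ')) _) hμ₀.le
  · set D := effectiveField A ω gradN ξ - effectiveField A ω gradN ξ'
    have hκ' : ∀ η, ‖κ η‖ = √θ * ‖η‖ := fun η => by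
      rw [← Real.sqrt_sq (norm_nonneg (κ η)), hκ, Real.sqrt_mul hθ.le,
        Real.sqrt_sq (norm_nonneg _)]
    -- Pair the difference with itself; the two constant fields contribute `√θ` each, cancelling
    -- `θ⁻¹`.
    have h1 : ‖D‖ ^ 2 ≤ μ₁ ^ 2 / μ₀ * ‖ξ - ξ'‖ * ‖D‖ := by
      rw [← real_inner_self_eq_norm_sq, hdiff]
      calc θ⁻¹ * inner ℝ (B ξ - B ξ') (κ D)
          ≤ θ⁻¹ * (μ₁ * (μ₁ / μ₀ * ‖κ (ξ - ξ')‖) * ‖κ D‖) := by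
            gcongr
            refine (real_inner_le_norm _ _).trans ?_
            gcongr
            exact (hlip ξ ξ').trans (by gcongr; exact hp ξ ξ')
        _ = θ⁻¹ * (√θ * √θ) * (μ₁ ^ 2 / μ₀ * ‖ξ - ξ'‖ * ‖D‖) := by
            rw [hκ', hκ']; ring
        _ = _ := by rw [Real.mul_self_sqrt hθ.le, inv_mul_cancel₀ hθ.ne', one_mul]
    rcases (norm_nonneg D).eq_or_lt with h0 | h0
    · rw [← h0]; positivity
    · refine le_of_mul_le_mul_right ?_ h0
      rwa [← sq]
  -- `p 0` is itself a corrector gradient, hence orthogonal to its own flux, and monotonicity forces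
  -- it to vanish.
  · have hp0 : p 0 = 0 := by
      have h1 := hA.superposition_monotone (p 0) 0
      rw [hA.superposition_zero, sub_zero, sub_zero] at h1
      have h2 : inner ℝ (hA.superposition ω (p 0)) (p 0) = 0 := by
        have : p 0 = (h 0).gradLp := by simp only [p, κ, map_zero, zero_add]
        nth_rewrite 2 [this]
        exact horth 0 0
      rw [h2] at h1
      have h3 : ‖p 0‖ ^ 2 ≤ 0 := by nlinarith
      exact norm_eq_zero.1 (pow_eq_zero_iff two_ne_zero |>.1 (le_antisymm h3 (sq_nonneg _)))
    refine ext_inner_right ℝ fun ζ => ?_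
    rw [hfield, inner_zero_left]
    simp only [B, hp0, hA.superposition_zero, inner_zero_left, mul_zero]
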